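/- Work on $\mathbb{R}^2$ with coordinates $(x_a,x_b)$ and dual frequencies $(\xi_a,\xi_b)$ (convention $\partial_{x_j}\leftrightarrow i\xi_j$). For $t\in\mathbb{R}$ let $K_t$ be the kernel of the linear equation $\partial_t u+\partial_{x_a}^3u+\partial_{x_b}^3u=0$, that is, convolution with $K_t$ is the Fourier multiplier with symbol $\widehat{K}_t(\xi_a,\xi_b)=e^{it(\xi_a^3+\xi_b^3)}$, and let $|\partial_{x_j}|^{1/2}$ be the Fourier multiplier with symbol $|\xi_j|^{1/2}$, $j\in\{a,b\}$. For $T\ge 1$ and a family $u(t)\in H^3(\mathbb{R}^2)$, $t\in[1,T]$, define the profile $f(t)=K_{-t}\ast u(t)$ and $$\|u\|_{X,T}=\sup_{t\in[1,T]}\max\left(\|u(t)\|_{H^3},\ \|x_af(t)\|_{L^2},\ \|x_bf(t)\|_{L^2}\right)\in[0,\infty].$$ Lemma (dispersive estimate). For every $\varepsilon>0$ there is a constant $C=C(\varepsilon)<\infty$ such that for every $T\ge 1$, every family $u(t)\in H^3(\mathbb{R}^2)$, $t\in[1,T]$ (in particular every $H^3$ solution on $[1,T]$ of the modified Zakharov–Kuznetsov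 equation $\partial_tu+\partial_{x_a}^3u+\partial_{x_b}^3u+(\partial_{x_a}+\partial_{x_b})(u^3)=0$), and every $t\in[1,T]$, $$\begin{aligned} \|u(t)\|_{L^\infty}&\le C\,t^{-\frac23+\varepsilon}\,\|u\|_{X,T},\\ \|\nabla u(t)\|_{L^\infty}&\le C\,t^{-\frac59+\varepsilon}\,\|u\|_{X,T},\\ \||\partial_{x_a}|^{1/2}u(t)\|_{L^\infty}&\le C\,t^{-\frac23-\frac16+\varepsilon}\,\|u\|_{X,T},\\ \||\partial_{x_b}|^{1/2}u(t)\|_{L^\infty}&\le C\,t^{-\frac23-\frac16+\varepsilon}\,\|u\|_{X,T}. \end{aligned}$$ -/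

import Mathlib

open MeasureTheory Set
open scoped ENNReal NNReal FourierTransform

noncomputable section

namespace ZK

/-- The plane with coordinates `x_a = x 0`, `x_b = x 1`. -/
abbrev Plane : Type := EuclideanSpace ℝ (Fin 2)

/-- (Classes of) square integrable functions on the plane. Its Fourier transform `𝓕` is the
Plancherel transform, normalised as `∫ exp(-2πi x·ξ) g(x) dx`; so the frequency dual to `∂/∂x_j`
in the convention `∂_j ↔ i ξ_j` is `2π ξ j`. -/
abbrev L2 : Type := Lp (α := Plane) ℂ 2 (volume : Measure Plane)

/-- `g` lies in the domain of the Fourier multiplier with symbol `m`, as an operator on `L²`. -/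
def InDomain (m : Plane → ℂ) (g : L2) : Prop :=
  MemLp (fun ξ => m ξ * (𝓕 g : L2) ξ) 2 volume

open Classical in
/-- The Fourier multiplier `m(D)` with symbol `m`: the `L²` function whose Fourier transform is
`m · 𝓕 g` (and `0` when `g` is not in the domain). -/
def fourierMultiplier (m : Plane → ℂ) (g : L2) : L2 :=
  if h : InDomain m g then 𝓕⁻ (MemLp.toLp _ h : L2) else 0

/-- The Sobolev norm `‖g‖_{H³} = ‖(1 - Δ)^{3/2} g‖_{L²}`, infinite when `g ∉ H³`. -/
def H3norm (g : L2) : ℝ≥0∞ :=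
  eLpNorm (fun ξ => (((1 + ‖(2 * Real.pi) • ξ‖ ^ 2) ^ (3 / 2 : ℝ) : ℝ) : ℂ) * (𝓕 g : L2) ξ)
    2 volume

/-- The Fourier transform `exp(i t (ξ_a³ + ξ_b³))` of the kernel `K_t` of the linear evolution
`∂_t u + ∂_a³ u + ∂_b³ u = 0`. -/
def kernelSymbol (t : ℝ) (ξ : Plane) : ℂ :=
  Complex.exp (Complex.I * (t * ((2 * Real.pi * ξ 0) ^ 3 + (2 * Real.pi * ξ 1) ^ 3) : ℝ))

/-- Convolution `K_t * g` with the kernel of the linear evolution. -/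
def linearFlow (t : ℝ) (g : L2) : L2 := fourierMultiplier (kernelSymbol t) g

/-- The profile `f(t) = K_{-t} * u(t)`. -/
def profile (u : ℝ → L2) (t : ℝ) : L2 := linearFlow (-t) (u t)

/-- Symbol of `∂_j`. -/
def derivSymbol (j : Fin 2) (ξ : Plane) : ℂ := Complex.I * (2 * Real.pi * ξ j : ℝ)

/-- The (weak) partial derivative `∂_j g`. -/
def partialDeriv (j : Fin 2) (g : L2) : L2 := fourierMultiplier (derivSymbol j) g

/-- The gradient `∇g = (∂_a g, ∂_b g)`. -/
def gradient (g : L2) (x : Plane) : EuclideanSpace ℂ (Fin 2) :=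
  !₂[partialDeriv 0 g x, partialDeriv 1 g x]

/-- Symbol of `|∂_j|^{1/2}`. -/
def halfDerivSymbol (j : Fin 2) (ξ : Plane) : ℂ := ((|2 * Real.pi * ξ j| ^ (1 / 2 : ℝ) : ℝ) : ℂ)

/-- The fractional derivative `|∂_j|^{1/2} g`. -/
def halfDeriv (j : Fin 2) (g : L2) : L2 := fourierMultiplier (halfDerivSymbol j) g

/-- `‖u‖_{X,T} = sup_{t ∈ [1,T]} max (‖u(t)‖_{H³}, ‖x_a f(t)‖_{L²}, ‖x_b f(t)‖_{L²})`. -/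
def Xnorm (T : ℝ) (u : ℝ → L2) : ℝ≥0∞ :=
  ⨆ t ∈ Icc 1 T, max (H3norm (u t))
    (max (eLpNorm (fun x : Plane => ((x 0 : ℝ) : ℂ) * profile u t x) 2 volume)
      (eLpNorm (fun x : Plane => ((x 1 : ℝ) : ℂ) * profile u t x) 2 volume))

/-- On its domain, `m(D)` really has the symbol `m`. -/
theorem fourier_fourierMultiplier {m : Plane → ℂ} {g : L2} (h : InDomain m g) :
    ((𝓕 (fourierMultiplier m g) : L2) : Plane → ℂ) =ᵐ[volume] fun ξ => m ξ * (𝓕 g : L2) ξ := by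
  rw [fourierMultiplier, dif_pos h, FourierTransform.fourier_fourierInv_eq]
  exact MemLp.coeFn_toLp h

/-- `K_t * g` is defined for every `g ∈ L²`. -/
theorem inDomain_kernelSymbol (t : ℝ) (g : L2) : InDomain (kernelSymbol t) g := by
  have hm : Measurable (kernelSymbol t) := by
    unfold kernelSymbol
    fun_prop
  refine (Lp.memLp (𝓕 g : L2)).of_le (hm.aestronglyMeasurable.mul (Lp.aestronglyMeasurable _)) ?_
  refine Filter.Eventually.of_forall fun ξ => ?_
  rw [norm_mul, kernelSymbol, mul_comm Complex.I, Complex.norm_exp_ofReal_mul_I, one_mul]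

theorem inDomain_of_le {m : Plane → ℂ} (hm : Measurable m)
    (hle : ∀ ξ, ‖m ξ‖ ≤ (1 + ‖(2 * Real.pi) • ξ‖ ^ 2) ^ (3 / 2 : ℝ)) {g : L2}
    (hg : H3norm g < ∞) : InDomain m g := by
  have hw : Measurable fun ξ : Plane =>
      (((1 + ‖(2 * Real.pi) • ξ‖ ^ 2) ^ (3 / 2 : ℝ) : ℝ) : ℂ) := by fun_prop
  have hmem : MemLp (fun ξ : Plane =>
      (((1 + ‖(2 * Real.pi) • ξ‖ ^ 2) ^ (3 / 2 : ℝ) : ℝ) : ℂ) * (𝓕 g : L2) ξ) 2 volume :=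
    ⟨hw.aestronglyMeasurable.mul (Lp.aestronglyMeasurable _), hg⟩
  refine hmem.of_le (hm.aestronglyMeasurable.mul (Lp.aestronglyMeasurable _)) ?_
  refine Filter.Eventually.of_forall fun ξ => ?_
  rw [norm_mul, norm_mul, Complex.norm_real, Real.norm_of_nonneg (by positivity)]
  exact mul_le_mul_of_nonneg_right (hle ξ) (norm_nonneg _)

theorem coord_sq_le (j : Fin 2) (ξ : Plane) :
    (2 * Real.pi * ξ j) ^ 2 ≤ ‖(2 * Real.pi) • ξ‖ ^ 2 := by
  have h := PiLp.norm_apply_le ((2 * Real.pi) • ξ) j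
  rw [PiLp.smul_apply, smul_eq_mul, Real.norm_eq_abs] at h
  rw [← sq_abs (2 * Real.pi * ξ j)]
  gcongr

/-- `∂_j g` is defined for every `g ∈ H³`. -/
theorem inDomain_derivSymbol (j : Fin 2) {g : L2} (hg : H3norm g < ∞) :
    InDomain (derivSymbol j) g := by
  refine inDomain_of_le (by unfold derivSymbol; fun_prop) (fun ξ => ?_) hg
  rw [derivSymbol, norm_mul, Complex.norm_I, one_mul, Complex.norm_real, Real.norm_eq_abs]
  have h := coord_sq_le j ξ
  set a := ‖(2 * Real.pi) • ξ‖ ^ 2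
  have ha : 1 ≤ 1 + a := by simp only [le_add_iff_nonneg_right, a]; positivity
  calc |2 * Real.pi * ξ j| ≤ 1 + a := by
        rw [← sq_abs] at h; nlinarith [sq_nonneg (|2 * Real.pi * ξ j| - 1)]
    _ = (1 + a) ^ (1 : ℝ) := (Real.rpow_one _).symm
    _ ≤ (1 + a) ^ (3 / 2 : ℝ) := Real.rpow_le_rpow_of_exponent_le ha (by norm_num)

/-- `|∂_j|^{1/2} g` is defined for every `g ∈ H³`. -/
theorem inDomain_halfDerivSymbol (j : Fin 2) {g : L2} (hg : H3norm g < ∞) :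
    InDomain (halfDerivSymbol j) g := by
  refine inDomain_of_le (by unfold halfDerivSymbol; fun_prop) (fun ξ => ?_) hg
  rw [halfDerivSymbol, Complex.norm_real, Real.norm_of_nonneg (by positivity)]
  have h := coord_sq_le j ξ
  set a := ‖(2 * Real.pi) • ξ‖ ^ 2
  have ha : 1 ≤ 1 + a := by simp only [le_add_iff_nonneg_right, a]; positivity
  calc |2 * Real.pi * ξ j| ^ (1 / 2 : ℝ) ≤ (1 + a) ^ (1 / 2 : ℝ) := by
        gcongr
        rw [← sq_abs] at h; nlinarith [sq_nonneg (|2 * Real.pi * ξ j| - 1)]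
    _ ≤ (1 + a) ^ (3 / 2 : ℝ) := Real.rpow_le_rpow_of_exponent_le ha (by norm_num)

open scoped LineDeriv in
/-- `∂_j g` is the derivative of `g` in the sense of distributions. -/
theorem toTemperedDistribution_partialDeriv (j : Fin 2) {g : L2}
    (h : InDomain (derivSymbol j) g) :
    (Lp.toTemperedDistribution (partialDeriv j g) : TemperedDistribution Plane ℂ) =
      ∂_{(EuclideanSpace.single j (1 : ℝ) : Plane)}
        (Lp.toTemperedDistribution g : TemperedDistribution Plane ℂ) := by
  set m : Plane := EuclideanSpace.single j (1 : ℝ) with hm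
  have key : 𝓕 (Lp.toTemperedDistribution (partialDeriv j g) : TemperedDistribution Plane ℂ) =
      𝓕 (∂_{m} (Lp.toTemperedDistribution g : TemperedDistribution Plane ℂ)) := by
    rw [TemperedDistribution.fourier_lineDerivOp_eq, Lp.fourier_toTemperedDistribution_eq,
      Lp.fourier_toTemperedDistribution_eq]
    ext φ
    have hg : (inner ℝ · m : Plane → ℝ).HasTemperateGrowth := by fun_prop
    have hg' : (fun x : Plane => ((inner ℝ x m : ℝ) : ℂ)).HasTemperateGrowth := by fun_prop
    simp only [_root_.smul_apply, TemperedDistribution.smulLeftCLM_apply_apply,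
      Lp.toTemperedDistribution_apply, smul_eq_mul]
    rw [← integral_const_mul]
    refine integral_congr_ae ?_
    filter_upwards [fourier_fourierMultiplier h] with ξ hξ
    rw [partialDeriv, hξ, SchwartzMap.smulLeftCLM_apply_apply hg', derivSymbol, hm,
      EuclideanSpace.inner_single_right]
    simp
    ring
  simpa using congrArg (fun z => 𝓕⁻ z) key

end ZK

end

/-!
The nonlinear equation plays no role: the claim is a bound on `m(D) K_t * f` for the symbols
`m = 1`, `i ξ_j` and `|ξ_j|^{1/2}`, where `f` is the profile at the fixed time `t`. Truncations
in frequency and in space reduce it to a pointwise bound on an explicit kernel and to the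
Cauchy–Schwarz inequality.

* *High frequencies.* Outside the square `|ξ_j| ≤ Λ` the Fourier inversion integral of `m(D) u` is
  controlled by the `H³` norm alone; for a symbol of order `r` this gives a bound of order
  `Λ^{r - 2}` up to an arbitrarily small power (`integral_norm_symbol_mul_fourier_le`).
* *The kernel.* Inside the square, `m(D) K_t` is convolution with a product of one-dimensional
  integrals `∫_{-Λ}^{Λ} μ(η) exp(i (z η + t η³)) dη`. By scaling, everything follows from the
  boundedness, uniform in `x` and `q`, of `∫_1^q ξ^{1/2} exp(i (x ξ + ξ³)) dξ`
  (`norm_integral_sqrt_phase_le`): the amplitude `ξ^{1/2}` is the square root of the second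
  derivative of the phase, up to a constant, which is exactly what the stationary phase heuristics
  can absorb. Near the stationary point the integral is estimated trivially, elsewhere by Abel's
  inequality, applied to monotone factors of the amplitude over the derivative of the phase. Abel's
  inequality also yields the amplitudes `1` and `ξ`, the latter with a loss of
  `(Λ t^{1/3})^{1/2}`.
* *The profile.* In two dimensions, the bounds on `f` and `x f` in `L²` just fail to give
  `f ∈ L¹`. But the part of `f` in the ball of radius `R` has an `L¹` norm of size at most an
  arbitrarily small power of `R` (`integral_norm_indicator_ball_le`), and is estimated by the
  supremum of the kernel; the rest is of size `R⁻¹` in `L²`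
  (`eLpNorm_indicator_compl_ball_le`), and is estimated by the `L²` norm of the truncated symbol.

The three contributions are added up in `ae_norm_fourierMultiplier_le`. The choice `R = t²` makes
the spatial tail harmless. For the gradient, the kernel bound is `t^{-5/6} Λ^{1/2}` and the high
frequencies contribute `Λ^{-1}`; they balance at `Λ = t^{5/9}`, which is the origin of the exponent
`5/9`. The same `Λ` also suffices for the other symbols.
-/
noncomputable section

namespace ZK

/-! ### Abel's inequality and the cubic phase -/

/-- Abel's inequality: integrating against a monotone weight costs at most the size and the
variation of the weight. -/
theorem norm_integral_mul_le_of_deriv_nonneg {p q B : ℝ} {w w' : ℝ → ℝ} {g : ℝ → ℂ} (hpq : p ≤ q)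
    (hw : ∀ x ∈ Icc p q, HasDerivAt w (w' x) x) (hw' : ContinuousOn w' (Icc p q))
    (hpos : ∀ x ∈ Icc p q, 0 ≤ w' x) (hg : ContinuousOn g (Icc p q))
    (hB : ∀ r ∈ Icc p q, ‖∫ x in p..r, g x‖ ≤ B) :
    ‖∫ x in p..q, (w x : ℂ) * g x‖ ≤ B * (|w q| + (w q - w p)) := by
  have hu : uIcc p q = Icc p q := uIcc_of_le hpq
  have hB0 : 0 ≤ B := (norm_nonneg _).trans (hB p (left_mem_Icc.2 hpq))
  have hgi : IntervalIntegrable g volume p q := (hu ▸ hg).intervalIntegrable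
  have hwi : IntervalIntegrable w' volume p q := (hu ▸ hw').intervalIntegrable
  have hGc : ContinuousOn (fun r => ∫ x in p..r, g x) (uIcc p q) :=
    intervalIntegral.continuousOn_primitive_interval (hu ▸ hg.integrableOn_Icc)
  have hparts := intervalIntegral.integral_mul_deriv_eq_deriv_mul_of_hasDerivAt
    (a := p) (b := q) (u := fun x => (w x : ℂ)) (v := fun r => ∫ x in p..r, g x)
    (u' := fun x => (w' x : ℂ)) (v' := g)
    (by
      rw [hu]
      exact fun x hx => (Complex.continuous_ofReal.continuousAt.comp
        (hw x hx).continuousAt).continuousWithinAt)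
    hGc
    (by
      rw [min_eq_left hpq, max_eq_right hpq]
      exact fun x hx => (hw x (Ioo_subset_Icc_self hx)).ofReal_comp)
    (by
      rw [min_eq_left hpq, max_eq_right hpq]
      intro x hx
      refine intervalIntegral.integral_hasDerivAt_right
        (hgi.mono_set (by rw [hu, uIcc_of_le hx.1.le]; exact Icc_subset_Icc_right hx.2.le)) ?_
        (hg.continuousAt (Icc_mem_nhds hx.1 hx.2))
      exact (hg.mono Ioo_subset_Icc_self).stronglyMeasurableAtFilter isOpen_Ioo x hx)
    (by rw [intervalIntegrable_iff] at hwi ⊢; exact hwi.ofReal) hgi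
  rw [hparts]
  have h1 : ‖∫ x in p..q, (w' x : ℂ) * ∫ y in p..x, g y‖ ≤ ∫ x in p..q, w' x * B := by
    refine intervalIntegral.norm_integral_le_of_norm_le hpq ?_ (hwi.mul_const B)
    refine Filter.Eventually.of_forall fun x hx => ?_
    have hx' := Ioc_subset_Icc_self hx
    rw [norm_mul, Complex.norm_real, Real.norm_of_nonneg (hpos x hx')]
    exact mul_le_mul_of_nonneg_left (hB x hx') (hpos x hx')
  have h2 : ∫ x in p..q, w' x = w q - w p :=
    intervalIntegral.integral_eq_sub_of_hasDerivAt (by rwa [hu]) hwi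
  rw [intervalIntegral.integral_mul_const, h2] at h1
  have h3 : ‖(w q : ℂ) * ∫ x in p..q, g x‖ ≤ |w q| * B := by
    rw [norm_mul, Complex.norm_real, Real.norm_eq_abs]
    exact mul_le_mul_of_nonneg_left (hB q (right_mem_Icc.2 hpq)) (abs_nonneg _)
  simp only [intervalIntegral.integral_same, mul_zero, sub_zero]
  refine (norm_sub_le _ _).trans ((add_le_add h3 h1).trans (le_of_eq (by ring)))

theorem norm_integral_mul_le_of_deriv_nonpos {p q B : ℝ} {w w' : ℝ → ℝ} {g : ℝ → ℂ} (hpq : p ≤ q)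
    (hw : ∀ x ∈ Icc p q, HasDerivAt w (w' x) x) (hw' : ContinuousOn w' (Icc p q))
    (hneg : ∀ x ∈ Icc p q, w' x ≤ 0) (hq : 0 ≤ w q) (hg : ContinuousOn g (Icc p q))
    (hB : ∀ r ∈ Icc p q, ‖∫ x in p..r, g x‖ ≤ B) :
    ‖∫ x in p..q, (w x : ℂ) * g x‖ ≤ B * w p := by
  have h := norm_integral_mul_le_of_deriv_nonneg hpq (w := fun x => -w x) (w' := fun x => -w' x)
    (fun x hx => (hw x hx).neg) hw'.neg (fun x hx => neg_nonneg.2 (hneg x hx)) hg hB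
  simp only [Complex.ofReal_neg, neg_mul, intervalIntegral.integral_neg, norm_neg, abs_neg,
    abs_of_nonneg hq] at h
  exact h.trans (le_of_eq (by ring))

/-- The oscillating factor `exp(i (x ξ + ξ³))`. -/
def cubicPhase (x ξ : ℝ) : ℂ := Complex.exp (Complex.I * ((x * ξ + ξ ^ 3 : ℝ) : ℂ))

theorem norm_cubicPhase (x ξ : ℝ) : ‖cubicPhase x ξ‖ = 1 := by
  rw [cubicPhase, mul_comm, Complex.norm_exp_ofReal_mul_I]

@[fun_prop]
theorem continuous_cubicPhase (x : ℝ) : Continuous (cubicPhase x) := by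
  unfold cubicPhase; fun_prop

theorem hasDerivAt_cubicPhase (x ξ : ℝ) :
    HasDerivAt (cubicPhase x)
      (Complex.I * (((x + 3 * ξ ^ 2 : ℝ) : ℂ) * cubicPhase x ξ)) ξ := by
  have h1 : HasDerivAt (fun ξ : ℝ => x * ξ + ξ ^ 3) (x + 3 * ξ ^ 2) ξ := by
    have := ((hasDerivAt_id ξ).const_mul x).add (hasDerivAt_pow 3 ξ)
    simpa using! this
  have h2 := (h1.ofReal_comp.const_mul Complex.I).cexp
  refine h2.congr_deriv ?_
  rw [cubicPhase]; ring

/-- The derivative of the phase times `cubicPhase` is an exact derivative, so its integrals are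
bounded. -/
theorem norm_integral_deriv_phase_le (x p r : ℝ) :
    ‖∫ ξ in p..r, ((x + 3 * ξ ^ 2 : ℝ) : ℂ) * cubicPhase x ξ‖ ≤ 2 := by
  have h := intervalIntegral.integral_eq_sub_of_hasDerivAt (a := p) (b := r)
    (fun ξ _ => hasDerivAt_cubicPhase x ξ)
    (Continuous.intervalIntegrable (by fun_prop) _ _)
  rw [intervalIntegral.integral_const_mul] at h
  have h2 := congrArg norm h
  rw [norm_mul, Complex.norm_I, one_mul] at h2
  rw [h2]
  refine (norm_sub_le _ _).trans ?_
  rw [norm_cubicPhase, norm_cubicPhase]; norm_num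


theorem hasDerivAt_sq_div_deriv_phase {x ξ : ℝ} (h : x + 3 * ξ ^ 2 ≠ 0) :
    HasDerivAt (fun ξ => ξ ^ 2 / (x + 3 * ξ ^ 2)) (2 * x * ξ / (x + 3 * ξ ^ 2) ^ 2) ξ := by
  have h1 : HasDerivAt (fun ξ : ℝ => ξ ^ 2) (2 * ξ) ξ := by simpa using hasDerivAt_pow 2 ξ
  have h2 : HasDerivAt (fun ξ : ℝ => x + 3 * ξ ^ 2) (6 * ξ) ξ :=
    ((h1.const_mul 3).const_add x).congr_deriv (by ring)
  exact (h1.div h2 h).congr_deriv (by ring)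

/-- Where the phase increases, the amplitude `ξ^{1/2}` is `ξ^{-3/2}` times
`ξ² / (x + 3 ξ²)` times the derivative of the phase; each factor is monotone. -/
theorem norm_integral_sqrt_phase_le_aux {x p q D : ℝ} (hp : 0 < p) (hpq : p ≤ q)
    (hφ : ∀ ξ ∈ Icc p q, 0 < x + 3 * ξ ^ 2)
    (hstep : ∀ r ∈ Icc p q, ‖∫ ξ in p..r, ((ξ ^ 2 / (x + 3 * ξ ^ 2) : ℝ) : ℂ) *
      (((x + 3 * ξ ^ 2 : ℝ) : ℂ) * cubicPhase x ξ)‖ ≤ D) :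
    ‖∫ ξ in p..q, ((ξ ^ (1 / 2 : ℝ) : ℝ) : ℂ) * cubicPhase x ξ‖ ≤ D * p ^ (-(3 / 2) : ℝ) := by
  have hξ0 : ∀ ξ ∈ Icc p q, 0 < ξ := fun ξ hξ => by linarith [hξ.1]
  have hmain := norm_integral_mul_le_of_deriv_nonpos hpq (w := fun ξ => ξ ^ (-(3 / 2) : ℝ))
    (w' := fun ξ => -(3 / 2) * ξ ^ (-(3 / 2) - 1 : ℝ))
    (g := fun ξ => ((ξ ^ 2 / (x + 3 * ξ ^ 2) : ℝ) : ℂ) *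
      (((x + 3 * ξ ^ 2 : ℝ) : ℂ) * cubicPhase x ξ))
    (fun ξ hξ => Real.hasDerivAt_rpow_const (Or.inl (hξ0 ξ hξ).ne'))
    (ContinuousOn.mul continuousOn_const
      (ContinuousOn.rpow_const continuousOn_id fun ξ hξ => Or.inl (hξ0 ξ hξ).ne'))
    (fun ξ hξ => by
      have := Real.rpow_nonneg (hξ0 ξ hξ).le (-(3 / 2) - 1)
      linarith)
    (Real.rpow_nonneg (by linarith) _)
    (ContinuousOn.mul (Complex.continuous_ofReal.comp_continuousOn
      (fun ξ hξ =>
        (hasDerivAt_sq_div_deriv_phase (hφ ξ hξ).ne').continuousAt.continuousWithinAt))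
      (Continuous.continuousOn (by fun_prop))) hstep
  refine le_trans (le_of_eq ?_) hmain
  congr 1
  refine intervalIntegral.integral_congr fun ξ hξ => ?_
  rw [uIcc_of_le hpq] at hξ
  have h0 := hξ0 ξ hξ
  have h1 := (hφ ξ hξ).ne'
  have h2 : ξ ^ (1 / 2 : ℝ) = ξ ^ (-(3 / 2) : ℝ) * (ξ ^ 2 / (x + 3 * ξ ^ 2)) *
      (x + 3 * ξ ^ 2) := by
    rw [mul_assoc, div_mul_cancel₀ _ h1, ← Real.rpow_natCast ξ 2, ← Real.rpow_add h0]
    norm_num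
  simp only [h2]
  push_cast
  ring

theorem continuousOn_deriv_sq_div_deriv_phase {x : ℝ} {s : Set ℝ}
    (hφ : ∀ ξ ∈ s, 0 < x + 3 * ξ ^ 2) :
    ContinuousOn (fun ξ : ℝ => 2 * x * ξ / (x + 3 * ξ ^ 2) ^ 2) s :=
  ContinuousOn.div (by fun_prop) (by fun_prop) fun ξ hξ => pow_ne_zero _ (hφ ξ hξ).ne'

/-- The non-stationary estimate to the right of the stationary point. -/
theorem norm_integral_sqrt_phase_le_right {x p q : ℝ} (hp : 0 < p) (hpq : p ≤ q)
    (hpos : 0 < x + 3 * p ^ 2) (hx : x ≤ 0) :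
    ‖∫ ξ in p..q, ((ξ ^ (1 / 2 : ℝ) : ℝ) : ℂ) * cubicPhase x ξ‖
      ≤ 2 * (p ^ 2 / (x + 3 * p ^ 2)) * p ^ (-(3 / 2) : ℝ) := by
  have hφ : ∀ ξ ∈ Icc p q, 0 < x + 3 * ξ ^ 2 := fun ξ hξ => by nlinarith [hξ.1]
  refine norm_integral_sqrt_phase_le_aux hp hpq hφ fun r hr => ?_
  have hs : Icc p r ⊆ Icc p q := Icc_subset_Icc_right hr.2
  refine norm_integral_mul_le_of_deriv_nonpos hr.1
    (fun ξ hξ => hasDerivAt_sq_div_deriv_phase (hφ ξ (hs hξ)).ne')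
    (continuousOn_deriv_sq_div_deriv_phase fun ξ hξ => hφ ξ (hs hξ))
    (fun ξ hξ => ?_) ?_ (Continuous.continuousOn (by fun_prop))
    (fun s _ => norm_integral_deriv_phase_le x p s)
  · have h0 : 0 ≤ ξ := hp.le.trans hξ.1
    exact div_nonpos_of_nonpos_of_nonneg (by nlinarith) (sq_nonneg _)
  · exact div_nonneg (sq_nonneg _) (hφ r hr).le

/-- For `x ≥ 0` there is no stationary point. -/
theorem norm_integral_sqrt_phase_le_of_nonneg {x q : ℝ} (hq : 1 ≤ q) (hx : 0 ≤ x) :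
    ‖∫ ξ in (1 : ℝ)..q, ((ξ ^ (1 / 2 : ℝ) : ℝ) : ℂ) * cubicPhase x ξ‖ ≤ 4 / 3 := by
  have hφ : ∀ ξ ∈ Icc 1 q, 0 < x + 3 * ξ ^ 2 := fun ξ hξ => by nlinarith [hξ.1]
  refine (norm_integral_sqrt_phase_le_aux (D := 4 / 3) one_pos hq hφ fun r hr => ?_).trans
    (by rw [Real.one_rpow, mul_one])
  have hs : Icc 1 r ⊆ Icc 1 q := Icc_subset_Icc_right hr.2
  refine (norm_integral_mul_le_of_deriv_nonneg hr.1
    (fun ξ hξ => hasDerivAt_sq_div_deriv_phase (hφ ξ (hs hξ)).ne')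
    (continuousOn_deriv_sq_div_deriv_phase fun ξ hξ => hφ ξ (hs hξ))
    (fun ξ hξ => ?_) (Continuous.continuousOn (by fun_prop))
    (fun s _ => norm_integral_deriv_phase_le x 1 s)).trans ?_
  · have h0 : 0 ≤ ξ := zero_le_one.trans hξ.1
    positivity
  · have h1 : r ^ 2 / (x + 3 * r ^ 2) ≤ 1 / 3 := by
      rw [div_le_div_iff₀ (hφ r hr) (by norm_num)]; linarith
    have h2 : 0 ≤ r ^ 2 / (x + 3 * r ^ 2) := div_nonneg (sq_nonneg _) (hφ r hr).le
    have h3 : 0 ≤ (1 : ℝ) ^ 2 / (x + 3 * 1 ^ 2) := by positivity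
    rw [abs_of_nonneg h2]
    linarith

/-- The non-stationary estimate to the left of the stationary point. -/
theorem norm_integral_sqrt_phase_le_left {x p q : ℝ} (hp : 0 < p) (hpq : p ≤ q)
    (hneg : x + 3 * q ^ 2 < 0) :
    ‖∫ ξ in p..q, ((ξ ^ (1 / 2 : ℝ) : ℝ) : ℂ) * cubicPhase x ξ‖
      ≤ 8 * (q ^ (1 / 2 : ℝ) / -(x + 3 * q ^ 2)) := by
  have hξ0 : ∀ ξ ∈ Icc p q, 0 < ξ := fun ξ hξ => hp.trans_le hξ.1
  have hφ : ∀ ξ ∈ Icc p q, 0 < -(x + 3 * ξ ^ 2) := fun ξ hξ => by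
    nlinarith [hξ.2, hξ0 ξ hξ]
  have hd : ∀ ξ ∈ Icc p q, HasDerivAt (fun ξ => (-(x + 3 * ξ ^ 2))⁻¹)
      (6 * ξ / (-(x + 3 * ξ ^ 2)) ^ 2) ξ := by
    intro ξ hξ
    have h1 : HasDerivAt (fun ξ : ℝ => ξ ^ 2) (2 * ξ) ξ := by simpa using hasDerivAt_pow 2 ξ
    have h2 : HasDerivAt (fun ξ : ℝ => -(x + 3 * ξ ^ 2)) (-(6 * ξ)) ξ :=
      ((h1.const_mul 3).const_add x).neg.congr_deriv (by ring)
    exact (h2.fun_inv (hφ ξ hξ).ne').congr_deriv (by rw [neg_neg])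
  set M := (-(x + 3 * q ^ 2))⁻¹ with hM
  have hstep : ∀ r ∈ Icc p q, ‖∫ ξ in p..r, (((-(x + 3 * ξ ^ 2))⁻¹ : ℝ) : ℂ) *
      (((x + 3 * ξ ^ 2 : ℝ) : ℂ) * cubicPhase x ξ)‖ ≤ 4 * M := by
    intro r hr
    have hs : Icc p r ⊆ Icc p q := Icc_subset_Icc_right hr.2
    refine (norm_integral_mul_le_of_deriv_nonneg hr.1 (fun ξ hξ => hd ξ (hs hξ))
      (ContinuousOn.div (by fun_prop) (by fun_prop)
        fun ξ hξ => pow_ne_zero _ (hφ ξ (hs hξ)).ne')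
      (fun ξ hξ => ?_) (Continuous.continuousOn (by fun_prop))
      (fun s _ => norm_integral_deriv_phase_le x p s)).trans ?_
    · have := hξ0 ξ (hs hξ)
      positivity
    · have h1 : (-(x + 3 * r ^ 2))⁻¹ ≤ M := by
        refine inv_anti₀ (hφ q (right_mem_Icc.2 hpq)) ?_
        have := pow_le_pow_left₀ (hξ0 r hr).le hr.2 2
        linarith
      have h2 := inv_pos.2 (hφ r hr)
      have h3 := inv_pos.2 (hφ p (left_mem_Icc.2 hpq))
      rw [abs_of_pos h2]
      linarith
  have hmain := norm_integral_mul_le_of_deriv_nonneg hpq (w := fun ξ => ξ ^ (1 / 2 : ℝ))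
    (w' := fun ξ => (1 / 2) * ξ ^ (1 / 2 - 1 : ℝ))
    (g := fun ξ => (((-(x + 3 * ξ ^ 2))⁻¹ : ℝ) : ℂ) *
      (((x + 3 * ξ ^ 2 : ℝ) : ℂ) * cubicPhase x ξ))
    (fun ξ hξ => Real.hasDerivAt_rpow_const (Or.inl (hξ0 ξ hξ).ne'))
    (ContinuousOn.mul continuousOn_const
      (ContinuousOn.rpow_const continuousOn_id fun ξ hξ => Or.inl (hξ0 ξ hξ).ne'))
    (fun ξ hξ => by
      have := Real.rpow_nonneg (hξ0 ξ hξ).le (1 / 2 - 1)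
      positivity)
    (ContinuousOn.mul (Complex.continuous_ofReal.comp_continuousOn
      (fun ξ hξ => (hd ξ hξ).continuousAt.continuousWithinAt))
      (Continuous.continuousOn (by fun_prop))) hstep
  have hq0 : 0 < q := hξ0 q (right_mem_Icc.2 hpq)
  have hM0 : 0 < M := inv_pos.2 (hφ q (right_mem_Icc.2 hpq))
  refine le_trans (le_of_eq ?_) (hmain.trans ?_)
  · rw [← norm_neg, ← intervalIntegral.integral_neg]
    congr 1
    refine intervalIntegral.integral_congr fun ξ hξ => ?_
    rw [uIcc_of_le hpq] at hξ
    have h1 : (((x + 3 * ξ ^ 2 : ℝ)) : ℂ) ≠ 0 :=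
      Complex.ofReal_ne_zero.2 (neg_ne_zero.1 (hφ ξ hξ).ne')
    simp only [Complex.ofReal_inv, Complex.ofReal_neg, inv_neg]
    field_simp
  · have h1 := Real.rpow_nonneg hq0.le (1 / 2)
    have h2 := Real.rpow_nonneg hp.le (1 / 2)
    simp only [abs_of_nonneg h1]
    rw [div_eq_mul_inv (q ^ (1 / 2 : ℝ)), ← hM]
    nlinarith [mul_nonneg hM0.le h2]

/-! ### One-dimensional oscillatory integrals -/

theorem intervalIntegrable_rpow_mul_cubicPhase {s : ℝ} (hs : 0 ≤ s) (x p q : ℝ) :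
    IntervalIntegrable (fun ξ => ((ξ ^ s : ℝ) : ℂ) * cubicPhase x ξ) volume p q :=
  ((Complex.continuous_ofReal.comp (Real.continuous_rpow_const hs)).mul
    (continuous_cubicPhase x)).intervalIntegrable _ _

/-- Near the stationary point the trivial bound is used. -/
theorem norm_integral_sqrt_phase_le_near {x p q b δ : ℝ} (hp : 0 ≤ p) (hpq : p ≤ q)
    (hb : 1 ≤ b) (hδ : δ ≤ 1) (hbδ : δ * b ^ (1 / 2 : ℝ) = 1)
    (h1 : b - δ ≤ p) (h2 : q ≤ b + δ) :
    ‖∫ ξ in p..q, ((ξ ^ (1 / 2 : ℝ) : ℝ) : ℂ) * cubicPhase x ξ‖ ≤ 4 := by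
  have hb0 : 0 ≤ b ^ (1 / 2 : ℝ) := Real.rpow_nonneg (by linarith) _
  have hbound := intervalIntegral.norm_integral_le_of_norm_le_const (a := p) (b := q)
    (C := 2 * b ^ (1 / 2 : ℝ))
    (f := fun ξ => ((ξ ^ (1 / 2 : ℝ) : ℝ) : ℂ) * cubicPhase x ξ) (fun ξ hξ => by
      rw [uIoc_of_le hpq] at hξ
      have hξ0 : 0 ≤ ξ := hp.trans hξ.1.le
      rw [norm_mul, norm_cubicPhase, mul_one, Complex.norm_real,
        Real.norm_of_nonneg (Real.rpow_nonneg hξ0 _)]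
      calc ξ ^ (1 / 2 : ℝ) ≤ (2 ^ 2 * b) ^ (1 / 2 : ℝ) :=
            Real.rpow_le_rpow hξ0 (by linarith [hξ.2]) (by norm_num)
        _ = 2 * b ^ (1 / 2 : ℝ) := by
            rw [Real.mul_rpow (by norm_num) (by linarith), ← Real.sqrt_eq_rpow,
              Real.sqrt_sq (by norm_num)])
  refine hbound.trans ?_
  rw [abs_of_nonneg (sub_nonneg.2 hpq)]
  nlinarith

/-- The amplitude `ξ^{1/2}` is balanced by the second derivative `6 ξ` of the phase: a stationary
point `a` contributes `a^{1/2}` times the length scale `a^{-1/2}`, so the oscillatory integral is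
bounded uniformly in `x` and `q`. -/
theorem norm_integral_sqrt_phase_le {x q : ℝ} (hq : 1 ≤ q) :
    ‖∫ ξ in (1 : ℝ)..q, ((ξ ^ (1 / 2 : ℝ) : ℝ) : ℂ) * cubicPhase x ξ‖ ≤ 8 := by
  rcases le_total 0 x with hx | hx
  · exact (norm_integral_sqrt_phase_le_of_nonneg hq hx).trans (by norm_num)
  obtain ⟨a, ha, hxa⟩ : ∃ a : ℝ, 0 ≤ a ∧ x = -3 * a ^ 2 :=
    ⟨√(-x / 3), Real.sqrt_nonneg _, by rw [Real.sq_sqrt (by linarith)]; ring⟩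
  -- `b` replaces `a` when the stationary point is close to the origin; `δ` is the length scale
  -- at which the quadratic term of the phase at `b` becomes of order one
  set b := max a 1 with hb
  have hb1 : 1 ≤ b := le_max_right _ _
  have hab : a ≤ b := le_max_left _ _
  have hs1 : 1 ≤ b ^ (1 / 2 : ℝ) := Real.one_le_rpow hb1 (by norm_num)
  set δ := (b ^ (1 / 2 : ℝ))⁻¹ with hδ
  have hδ1 : δ ≤ 1 := inv_le_one_of_one_le₀ hs1
  have hδ0 : 0 < δ := inv_pos.2 (by linarith)
  have hbδ : δ * b ^ (1 / 2 : ℝ) = 1 := inv_mul_cancel₀ (by linarith)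
  set p₁ := max 1 (min q (b - δ)) with hp₁
  set p₂ := max 1 (min q (b + δ)) with hp₂
  have h01 : 1 ≤ p₁ := le_max_left _ _
  have h12 : p₁ ≤ p₂ := max_le_max le_rfl (min_le_min le_rfl (by linarith))
  have h2q : p₂ ≤ q := max_le hq (min_le_left _ _)
  have hI := fun p q => intervalIntegrable_rpow_mul_cubicPhase (s := 1 / 2) (by norm_num) x p q
  rw [← intervalIntegral.integral_add_adjacent_intervals (hI 1 p₁) (hI p₁ q),
    ← intervalIntegral.integral_add_adjacent_intervals (hI p₁ p₂) (hI p₂ q)]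
  -- left of the stationary point; this piece is empty unless `b = a`
  have hA : ‖∫ ξ in (1 : ℝ)..p₁, ((ξ ^ (1 / 2 : ℝ) : ℝ) : ℂ) * cubicPhase x ξ‖ ≤ 8 / 3 := by
    rcases h01.eq_or_lt with h | h
    · rw [← h]; simp; norm_num
    have h' : p₁ ≤ b - δ := by
      rcases le_max_iff.1 (le_of_eq hp₁) with h3 | h3
      · linarith
      · exact h3.trans (min_le_right _ _)
    have hba : b = a := by
      rcases max_choice a 1 with h3 | h3
      · exact h3
      · rw [← hb] at h3; linarith
    have hlow : 3 * (δ * b) ≤ -(x + 3 * p₁ ^ 2) := by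
      rw [hxa, ← hba]; nlinarith
    have hδb : 0 < δ * b := by positivity
    refine (norm_integral_sqrt_phase_le_left one_pos h01 (by linarith)).trans ?_
    have hp1b : p₁ ^ (1 / 2 : ℝ) ≤ b ^ (1 / 2 : ℝ) :=
      Real.rpow_le_rpow (by linarith) (by linarith) (by norm_num)
    have hbb : b ^ (1 / 2 : ℝ) * b ^ (1 / 2 : ℝ) = b := by
      rw [← Real.rpow_add (by linarith)]; norm_num
    have : p₁ ^ (1 / 2 : ℝ) / -(x + 3 * p₁ ^ 2) ≤ 1 / 3 := by
      rw [div_le_div_iff₀ (by linarith) (by norm_num)]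
      have : δ * b = b ^ (1 / 2 : ℝ) := by
        calc δ * b = δ * b ^ (1 / 2 : ℝ) * b ^ (1 / 2 : ℝ) := by rw [mul_assoc, hbb]
          _ = _ := by rw [hbδ, one_mul]
      linarith
    linarith
  have hB : ‖∫ ξ in p₁..p₂, ((ξ ^ (1 / 2 : ℝ) : ℝ) : ℂ) * cubicPhase x ξ‖ ≤ 4 := by
    rcases h12.eq_or_lt with h | h
    · rw [h]; simp
    refine norm_integral_sqrt_phase_le_near (b := b) (δ := δ) (by linarith) h12 hb1 hδ1 hbδ ?_ ?_
    · by_contra! h3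
      have h4 : q < b - δ := by
        rcases min_lt_iff.1 ((le_max_right 1 (min q (b - δ))).trans_lt h3) with h4 | h4
        · exact h4
        · exact absurd h4 (lt_irrefl _)
      have h5 : p₁ = q := by rw [hp₁, min_eq_left h4.le, max_eq_right hq]
      linarith
    · rcases le_max_iff.1 (le_of_eq hp₂) with h3 | h3
      · linarith
      · exact h3.trans (min_le_right _ _)
  -- right of the stationary point
  have hC : ‖∫ ξ in p₂..q, ((ξ ^ (1 / 2 : ℝ) : ℝ) : ℂ) * cubicPhase x ξ‖ ≤ 4 / 3 := by
    rcases h2q.eq_or_lt with h | h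
    · rw [h]; simp; norm_num
    have h3 : b + δ ≤ p₂ := by
      by_contra! h3
      have h4 : q < b + δ := by
        rcases min_lt_iff.1 ((le_max_right 1 (min q (b + δ))).trans_lt h3) with h4 | h4
        · exact h4
        · exact absurd h4 (lt_irrefl _)
      have h5 : p₂ = q := by rw [hp₂, min_eq_left h4.le, max_eq_right hq]
      linarith
    have hp0 : 0 < p₂ := by linarith
    have hlow : 3 * (δ * p₂) ≤ x + 3 * p₂ ^ 2 := by
      rw [hxa]; nlinarith
    have hδp : 0 < δ * p₂ := by positivity
    refine (norm_integral_sqrt_phase_le_right hp0 h2q (by linarith) hx).trans ?_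
    have hpow : p₂ ^ 2 * p₂ ^ (-(3 / 2) : ℝ) = p₂ ^ (1 / 2 : ℝ) := by
      rw [← Real.rpow_natCast p₂ 2, ← Real.rpow_add hp0]; norm_num
    have hpp : p₂ ^ (1 / 2 : ℝ) * p₂ ^ (1 / 2 : ℝ) = p₂ := by
      rw [← Real.rpow_add hp0]; norm_num
    have hbp : b ^ (1 / 2 : ℝ) ≤ p₂ ^ (1 / 2 : ℝ) :=
      Real.rpow_le_rpow (by linarith) (by linarith) (by norm_num)
    have hδp' : p₂ ^ (1 / 2 : ℝ) ≤ δ * p₂ := by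
      have : 1 ≤ δ * p₂ ^ (1 / 2 : ℝ) :=
        hbδ.symm.le.trans (mul_le_mul_of_nonneg_left hbp hδ0.le)
      calc p₂ ^ (1 / 2 : ℝ) = 1 * p₂ ^ (1 / 2 : ℝ) := (one_mul _).symm
        _ ≤ δ * p₂ ^ (1 / 2 : ℝ) * p₂ ^ (1 / 2 : ℝ) := by gcongr
        _ = δ * p₂ := by rw [mul_assoc, hpp]
    have h6 : p₂ ^ 2 / (x + 3 * p₂ ^ 2) * p₂ ^ (-(3 / 2) : ℝ) ≤ 1 / 3 := by
      rw [div_mul_eq_mul_div, hpow, div_le_div_iff₀ (by linarith) (by norm_num)]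
      linarith
    linarith
  refine (norm_add_le _ _).trans ?_
  have := (norm_add_le (∫ ξ in p₁..p₂, ((ξ ^ (1 / 2 : ℝ) : ℝ) : ℂ) * cubicPhase x ξ)
    (∫ ξ in p₂..q, ((ξ ^ (1 / 2 : ℝ) : ℝ) : ℂ) * cubicPhase x ξ))
  linarith

theorem norm_integral_rpow_phase_zero_one_le {s : ℝ} (hs : 0 ≤ s) (x : ℝ) :
    ‖∫ ξ in (0 : ℝ)..1, ((ξ ^ s : ℝ) : ℂ) * cubicPhase x ξ‖ ≤ 1 := by
  refine (intervalIntegral.norm_integral_le_of_norm_le_const (C := 1) fun ξ hξ => ?_).trans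
    (by norm_num)
  rw [uIoc_of_le zero_le_one] at hξ
  rw [norm_mul, norm_cubicPhase, mul_one, Complex.norm_real,
    Real.norm_of_nonneg (Real.rpow_nonneg hξ.1.le _)]
  exact Real.rpow_le_one hξ.1.le hξ.2 hs

/-- Other amplitudes `ξ^s` are reduced to `ξ^{1/2}` by Abel's inequality with the monotone weight
`ξ^{s - 1/2}`. -/
theorem norm_integral_rpow_phase_le {s : ℝ} (hs : 0 ≤ s) {q : ℝ} (hq : 1 ≤ q) (x : ℝ) :
    ‖∫ ξ in (0 : ℝ)..q, ((ξ ^ s : ℝ) : ℂ) * cubicPhase x ξ‖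
      ≤ 17 * max 1 (q ^ (s - 1 / 2)) := by
  have hI := fun p q => intervalIntegrable_rpow_mul_cubicPhase hs x p q
  rw [← intervalIntegral.integral_add_adjacent_intervals (hI 0 1) (hI 1 q)]
  have h0 := norm_integral_rpow_phase_zero_one_le hs x
  have hξ0 : ∀ ξ ∈ Icc 1 q, 0 < ξ := fun ξ hξ => by linarith [hξ.1]
  have hd : ∀ ξ ∈ Icc 1 q, HasDerivAt (fun ξ : ℝ => ξ ^ (s - 1 / 2))
      ((s - 1 / 2) * ξ ^ (s - 1 / 2 - 1)) ξ :=
    fun ξ hξ => Real.hasDerivAt_rpow_const (Or.inl (hξ0 ξ hξ).ne')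
  have hc : ContinuousOn (fun ξ : ℝ => (s - 1 / 2) * ξ ^ (s - 1 / 2 - 1)) (Icc 1 q) :=
    ContinuousOn.mul continuousOn_const
      (ContinuousOn.rpow_const continuousOn_id fun ξ hξ => Or.inl (hξ0 ξ hξ).ne')
  have hg : ContinuousOn (fun ξ : ℝ => ((ξ ^ (1 / 2 : ℝ) : ℝ) : ℂ) * cubicPhase x ξ) (Icc 1 q) :=
    ((Complex.continuous_ofReal.comp (Real.continuous_rpow_const (by norm_num))).mul
      (continuous_cubicPhase x)).continuousOn
  have hB : ∀ r ∈ Icc 1 q,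
      ‖∫ ξ in (1 : ℝ)..r, ((ξ ^ (1 / 2 : ℝ) : ℝ) : ℂ) * cubicPhase x ξ‖ ≤ 8 :=
    fun r hr => norm_integral_sqrt_phase_le hr.1
  have hq0 : 0 ≤ q ^ (s - 1 / 2) := Real.rpow_nonneg (by linarith) _
  have hmain : ‖∫ ξ in (1 : ℝ)..q, ((ξ ^ (s - 1 / 2) : ℝ) : ℂ) *
      (((ξ ^ (1 / 2 : ℝ) : ℝ) : ℂ) * cubicPhase x ξ)‖ ≤ 16 * max 1 (q ^ (s - 1 / 2)) := by
    have hM1 := le_max_left 1 (q ^ (s - 1 / 2))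
    have hM2 := le_max_right 1 (q ^ (s - 1 / 2))
    rcases le_total (1 / 2) s with h | h
    · refine (norm_integral_mul_le_of_deriv_nonneg hq hd hc (fun ξ hξ => ?_) hg hB).trans ?_
      · exact mul_nonneg (by linarith) (Real.rpow_nonneg (hξ0 ξ hξ).le _)
      · rw [abs_of_nonneg hq0, Real.one_rpow]; linarith
    · refine (norm_integral_mul_le_of_deriv_nonpos hq hd hc (fun ξ hξ => ?_) hq0 hg hB).trans ?_
      · exact mul_nonpos_of_nonpos_of_nonneg (by linarith) (Real.rpow_nonneg (hξ0 ξ hξ).le _)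
      · rw [Real.one_rpow]; linarith
  have heq : ∫ ξ in (1 : ℝ)..q, ((ξ ^ s : ℝ) : ℂ) * cubicPhase x ξ =
      ∫ ξ in (1 : ℝ)..q, ((ξ ^ (s - 1 / 2) : ℝ) : ℂ) *
        (((ξ ^ (1 / 2 : ℝ) : ℝ) : ℂ) * cubicPhase x ξ) := by
    refine intervalIntegral.integral_congr fun ξ hξ => ?_
    rw [uIcc_of_le hq] at hξ
    rw [← mul_assoc, ← Complex.ofReal_mul, ← Real.rpow_add (hξ0 ξ hξ), sub_add_cancel]
  rw [heq]
  have := le_max_left 1 (q ^ (s - 1 / 2))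
  exact (norm_add_le _ _).trans (by linarith)

/-- The frequency integral over a symmetric interval, at a general time `t > 0`, for a symbol that
is a constant multiple of `|ξ|^s` on each half line. The negative half line is mapped to the
positive one by complex conjugation, and time is scaled to one by `ξ ↦ t^{1/3} ξ`. -/
theorem norm_integral_Icc_phase_le {s : ℝ} (hs : 0 ≤ s) {t L : ℝ} (ht : 0 < t)
    (hL : 1 ≤ t ^ (1 / 3 : ℝ) * L) {μ : ℝ → ℂ} {c₁ c₂ : ℂ} (hc₁ : ‖c₁‖ ≤ 1) (hc₂ : ‖c₂‖ ≤ 1)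
    (h₁ : ∀ ξ, 0 < ξ → μ ξ = c₁ * (ξ ^ s : ℝ)) (h₂ : ∀ ξ, 0 < ξ → μ (-ξ) = c₂ * (ξ ^ s : ℝ))
    (z : ℝ) :
    ‖∫ ξ in (-L)..L, μ ξ * Complex.exp (Complex.I * ((z * ξ + t * ξ ^ 3 : ℝ) : ℂ))‖
      ≤ 34 * t ^ (-(s + 1) / 3) * max 1 ((t ^ (1 / 3 : ℝ) * L) ^ (s - 1 / 2)) := by
  set τ := t ^ (1 / 3 : ℝ) with hτ
  have hτ0 : 0 < τ := Real.rpow_pos_of_pos ht _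
  have hτ3 : τ ^ 3 = t := by
    rw [hτ, ← Real.rpow_natCast, ← Real.rpow_mul ht.le]; norm_num
  have hL0 : 0 < L := pos_of_mul_pos_right (by linarith) hτ0.le
  set M := max 1 ((τ * L) ^ (s - 1 / 2))
  have hhalf : ∀ z : ℝ, ‖∫ ξ in (0 : ℝ)..L, ((ξ ^ s : ℝ) : ℂ) *
      Complex.exp (Complex.I * ((z * ξ + t * ξ ^ 3 : ℝ) : ℂ))‖ ≤
        t ^ (-(s + 1) / 3) * (17 * M) := by
    intro z
    have h := norm_integral_rpow_phase_le hs hL (z / τ)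
    have h2 : ∫ ξ in (0 : ℝ)..L, ((ξ ^ s : ℝ) : ℂ) *
        Complex.exp (Complex.I * ((z * ξ + t * ξ ^ 3 : ℝ) : ℂ)) =
        ((τ ^ (-s) : ℝ) : ℂ) * ∫ ξ in (0 : ℝ)..L, (((τ * ξ) ^ s : ℝ) : ℂ) *
          cubicPhase (z / τ) (τ * ξ) := by
      rw [← intervalIntegral.integral_const_mul]
      refine intervalIntegral.integral_congr fun ξ hξ => ?_
      rw [uIcc_of_le hL0.le] at hξ
      have e1 : ξ ^ s = τ ^ (-s) * (τ * ξ) ^ s := by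
        rw [Real.mul_rpow hτ0.le hξ.1, ← mul_assoc, ← Real.rpow_add hτ0]; simp
      have e2 : z * ξ + t * ξ ^ 3 = z / τ * (τ * ξ) + (τ * ξ) ^ 3 := by
        rw [← hτ3]; field_simp
      simp only [cubicPhase]
      rw [← e2, e1]; push_cast; ring
    rw [h2, intervalIntegral.integral_comp_mul_left
      (fun ξ => ((ξ ^ s : ℝ) : ℂ) * cubicPhase (z / τ) ξ) hτ0.ne', mul_zero, norm_mul, norm_smul,
      Complex.norm_real, Real.norm_of_nonneg (Real.rpow_nonneg hτ0.le _), Real.norm_of_nonneg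
      (inv_nonneg.2 hτ0.le), ← mul_assoc]
    have e3 : τ ^ (-s) * τ⁻¹ = t ^ (-(s + 1) / 3) := by
      rw [← Real.rpow_neg_one, ← Real.rpow_add hτ0, hτ, ← Real.rpow_mul ht.le]
      congr 1; ring
    rw [e3]
    exact mul_le_mul_of_nonneg_left h (Real.rpow_nonneg ht.le _)
  have hcont : ∀ z : ℝ, Continuous fun ξ : ℝ =>
      ((ξ ^ s : ℝ) : ℂ) * Complex.exp (Complex.I * ((z * ξ + t * ξ ^ 3 : ℝ) : ℂ)) := fun z =>
    (Complex.continuous_ofReal.comp (Real.continuous_rpow_const hs)).mul (by fun_prop)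
  have hpos : ∀ ξ ∈ Ioc 0 L, c₁ * (((ξ ^ s : ℝ) : ℂ) *
      Complex.exp (Complex.I * ((z * ξ + t * ξ ^ 3 : ℝ) : ℂ))) =
      μ ξ * Complex.exp (Complex.I * ((z * ξ + t * ξ ^ 3 : ℝ) : ℂ)) := fun ξ hξ => by
    rw [h₁ ξ hξ.1, mul_assoc]
  have hneg : ∀ ξ ∈ Ioc 0 L, c₂ * (starRingEnd ℂ) (((ξ ^ s : ℝ) : ℂ) *
      Complex.exp (Complex.I * ((z * ξ + t * ξ ^ 3 : ℝ) : ℂ))) =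
      μ (-ξ) * Complex.exp (Complex.I * ((z * (-ξ) + t * (-ξ) ^ 3 : ℝ) : ℂ)) := fun ξ hξ => by
    rw [h₂ ξ hξ.1, map_mul, ← Complex.exp_conj, map_mul, Complex.conj_ofReal, Complex.conj_ofReal,
      Complex.conj_I, mul_assoc]
    congr 3; push_cast; ring
  have hi1 : IntervalIntegrable (fun ξ => μ ξ *
      Complex.exp (Complex.I * ((z * ξ + t * ξ ^ 3 : ℝ) : ℂ))) volume 0 L :=
    ((hcont z).const_mul c₁).intervalIntegrable 0 L |>.congr (by
      rw [uIoc_of_le hL0.le]; exact hpos)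
  have hi2 : IntervalIntegrable (fun ξ => μ (-ξ) *
      Complex.exp (Complex.I * ((z * (-ξ) + t * (-ξ) ^ 3 : ℝ) : ℂ))) volume 0 L :=
    ((Complex.continuous_conj.comp (hcont z)).const_mul c₂).intervalIntegrable 0 L |>.congr (by
      rw [uIoc_of_le hL0.le]; exact hneg)
  have hi3 := (hi2.comp_sub_left 0)
  simp only [zero_sub, neg_neg, sub_zero] at hi3
  rw [← intervalIntegral.integral_add_adjacent_intervals hi3.symm hi1]
  have b1 : ‖∫ ξ in (0 : ℝ)..L, μ ξ *
      Complex.exp (Complex.I * ((z * ξ + t * ξ ^ 3 : ℝ) : ℂ))‖ ≤ t ^ (-(s + 1) / 3) * (17 * M) := by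
    rw [← intervalIntegral.integral_congr_ae (.of_forall (by rw [uIoc_of_le hL0.le]; exact hpos)),
      intervalIntegral.integral_const_mul, norm_mul]
    exact (mul_le_of_le_one_left (norm_nonneg _) hc₁).trans (hhalf z)
  have b2 : ‖∫ ξ in (-L)..0, μ ξ *
      Complex.exp (Complex.I * ((z * ξ + t * ξ ^ 3 : ℝ) : ℂ))‖ ≤ t ^ (-(s + 1) / 3) * (17 * M) := by
    have e := intervalIntegral.integral_comp_neg (a := 0) (b := L) (fun ξ : ℝ => μ ξ *
      Complex.exp (Complex.I * ((z * ξ + t * ξ ^ 3 : ℝ) : ℂ)))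
    rw [neg_zero] at e
    rw [← e, ← intervalIntegral.integral_congr_ae
      (.of_forall (by rw [uIoc_of_le hL0.le]; exact hneg)),
      intervalIntegral.integral_const_mul, norm_mul, intervalIntegral.intervalIntegral_conj,
      RCLike.norm_conj]
    exact (mul_le_of_le_one_left (norm_nonneg _) hc₂).trans (hhalf z)
  exact (norm_add_le _ _).trans ((add_le_add b2 b1).trans (le_of_eq (by ring)))

/-! ### Fourier integrals on `L¹ ∩ L²` -/

theorem continuous_fourier_of_integrable {F : Plane → ℂ} (hF : Integrable F) :
    Continuous (𝓕 F) :=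
  VectorFourier.fourierIntegral_continuous Real.continuous_fourierChar
    continuous_inner hF

theorem continuous_fourierInv_of_integrable {F : Plane → ℂ} (hF : Integrable F) :
    Continuous (𝓕⁻ F) := by
  have : (𝓕⁻ F) = fun x => 𝓕 F (-x) := funext fun x => Real.fourierInv_eq_fourier_neg F x
  rw [this]
  exact (continuous_fourier_of_integrable hF).comp continuous_neg

theorem norm_fourierInv_le_integral_norm (F : Plane → ℂ) (x : Plane) :
    ‖𝓕⁻ F x‖ ≤ ∫ ξ, ‖F ξ‖ :=
  VectorFourier.norm_fourierIntegral_le_integral_norm _ _ _ F x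

theorem integral_fourier_mul_eq_of_integrable {F G : Plane → ℂ} (hF : Integrable F)
    (hG : Integrable G) : ∫ ξ, 𝓕 F ξ * G ξ = ∫ x, F x * 𝓕 G x := by
  have h := VectorFourier.integral_fourierIntegral_smul_eq_flip (L := innerₗ Plane)
    (μ := volume) (ν := volume) Real.continuous_fourierChar continuous_inner hF hG
  rw [flip_innerₗ] at h
  exact h

theorem integral_fourierInv_mul_eq_of_integrable {F G : Plane → ℂ} (hF : Integrable F)
    (hG : Integrable G) : ∫ ξ, 𝓕⁻ F ξ * G ξ = ∫ x, F x * 𝓕⁻ G x := by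
  have h := VectorFourier.integral_fourierIntegral_smul_eq_flip (L := -innerₗ Plane)
    (μ := volume) (ν := volume) Real.continuous_fourierChar (by exact continuous_inner.neg) hF hG
  have h2 : (-innerₗ Plane).flip = -innerₗ Plane := by
    ext x y; simp [real_inner_comm]
  rw [h2] at h
  exact h

/-- For functions in `L¹ ∩ L²`, the Plancherel transform is given by the Fourier integral. -/
theorem coeFn_fourier_ae_eq {h : L2} (hi : Integrable h) :
    ((𝓕 h : L2) : Plane → ℂ) =ᵐ[volume] 𝓕 (h : Plane → ℂ) := by
  refine ae_eq_of_integral_contDiff_smul_eq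
    ((Lp.memLp (𝓕 h : L2)).locallyIntegrable (by norm_num))
    (continuous_fourier_of_integrable hi).locallyIntegrable fun g g_smooth g_cpt => ?_
  have hg₁ : HasCompactSupport (Complex.ofRealCLM ∘ g) := g_cpt.comp_left rfl
  have hg₂ : ContDiff ℝ ((⊤ : ℕ∞) : WithTop ℕ∞) (Complex.ofRealCLM ∘ g) :=
    Complex.ofRealCLM.contDiff.comp g_smooth
  set φ := hg₁.toSchwartzMap hg₂ with hφ
  have e := congrArg (fun T : TemperedDistribution Plane ℂ => T φ)
    (Lp.fourier_toTemperedDistribution_eq h)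
  simp only [TemperedDistribution.fourier_apply, Lp.toTemperedDistribution_apply, smul_eq_mul] at e
  calc ∫ x, g x • (𝓕 h : L2) x = ∫ x, φ x * (𝓕 h : L2) x := by simp [hφ]
    _ = ∫ x, 𝓕 (φ : Plane → ℂ) x * h x := by rw [← e, SchwartzMap.fourier_coe]
    _ = ∫ x, φ x * 𝓕 (h : Plane → ℂ) x := integral_fourier_mul_eq_of_integrable φ.integrable hi
    _ = _ := by simp [hφ]

/-- For functions in `L¹ ∩ L²`, the inverse Plancherel transform is given by the inverse Fourier
integral. -/
theorem coeFn_fourierInv_ae_eq {h : L2} (hi : Integrable h) :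
    ((𝓕⁻ h : L2) : Plane → ℂ) =ᵐ[volume] 𝓕⁻ (h : Plane → ℂ) := by
  refine ae_eq_of_integral_contDiff_smul_eq
    ((Lp.memLp (𝓕⁻ h : L2)).locallyIntegrable (by norm_num))
    (continuous_fourierInv_of_integrable hi).locallyIntegrable fun g g_smooth g_cpt => ?_
  have hg₁ : HasCompactSupport (Complex.ofRealCLM ∘ g) := g_cpt.comp_left rfl
  have hg₂ : ContDiff ℝ ((⊤ : ℕ∞) : WithTop ℕ∞) (Complex.ofRealCLM ∘ g) :=
    Complex.ofRealCLM.contDiff.comp g_smooth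
  set φ := hg₁.toSchwartzMap hg₂ with hφ
  have e := congrArg (fun T : TemperedDistribution Plane ℂ => T φ)
    (Lp.fourierInv_toTemperedDistribution_eq h)
  simp only [TemperedDistribution.fourierInv_apply, Lp.toTemperedDistribution_apply,
    smul_eq_mul] at e
  calc ∫ x, g x • (𝓕⁻ h : L2) x = ∫ x, φ x * (𝓕⁻ h : L2) x := by simp [hφ]
    _ = ∫ x, 𝓕⁻ (φ : Plane → ℂ) x * h x := by rw [← e, SchwartzMap.fourierInv_coe]
    _ = ∫ x, φ x * 𝓕⁻ (h : Plane → ℂ) x :=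
      integral_fourierInv_mul_eq_of_integrable φ.integrable hi
    _ = _ := by simp [hφ]

theorem fourierInv_add_of_integrable {F G : Plane → ℂ} (hF : Integrable F) (hG : Integrable G)
    (x : Plane) : 𝓕⁻ (fun ξ => F ξ + G ξ) x = 𝓕⁻ F x + 𝓕⁻ G x := by
  simp only [Real.fourierInv_eq, smul_add]
  have hb : Continuous fun p : Plane × Plane => (-innerₗ Plane) p.1 p.2 := continuous_inner.neg
  refine integral_add ?_ ?_
  · simpa using!
      (VectorFourier.fourierIntegral_convergent_iff Real.continuous_fourierChar hb x).2 hF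
  · simpa using!
      (VectorFourier.fourierIntegral_convergent_iff Real.continuous_fourierChar hb x).2 hG

/-- The `L¹ → L^∞` bound for the multiplier `G`, which is convolution with the kernel `𝓕⁻ G`. -/
theorem norm_fourierInv_mul_fourier_le {F G : Plane → ℂ} {B : ℝ} (hF : Integrable F)
    (hG : Integrable G) (hB : ∀ z, ‖𝓕⁻ G z‖ ≤ B) (x : Plane) :
    ‖𝓕⁻ (fun ξ => G ξ * 𝓕 F ξ) x‖ ≤ B * ∫ y, ‖F y‖ := by
  set Gx : Plane → ℂ := fun ξ => Real.fourierChar (inner ℝ ξ x) • G ξ with hGx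
  have hGxi : Integrable Gx := by
    have hb : Continuous fun p : Plane × Plane => (-innerₗ Plane) p.1 p.2 := continuous_inner.neg
    simpa using!
      (VectorFourier.fourierIntegral_convergent_iff Real.continuous_fourierChar hb x).2 hG
  have h1 : 𝓕⁻ (fun ξ => G ξ * 𝓕 F ξ) x = ∫ ξ, 𝓕 F ξ * Gx ξ := by
    rw [Real.fourierInv_eq]
    refine integral_congr_ae (.of_forall fun ξ => ?_)
    simp only [hGx, Circle.smul_def, smul_eq_mul]
    ring
  have h2 : ∀ y, 𝓕 Gx y = 𝓕⁻ G (x - y) := by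
    intro y
    rw [Real.fourierInv_eq, Real.fourier_eq]
    refine integral_congr_ae (.of_forall fun ξ => ?_)
    simp only [hGx, smul_smul, ← AddChar.map_add_eq_mul, inner_sub_right]
    congr 2; ring
  rw [h1, integral_fourier_mul_eq_of_integrable hF hGxi, ← integral_const_mul]
  refine norm_integral_le_of_norm_le (hF.norm.const_mul B) (.of_forall fun y => ?_)
  rw [norm_mul, h2, mul_comm]
  exact mul_le_mul_of_nonneg_right (hB _) (norm_nonneg _)

/-- The Cauchy–Schwarz inequality. -/
theorem integral_norm_mul_le_of_memLp_two {a b : Plane → ℂ} (ha : MemLp a 2) (hb : MemLp b 2) :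
    Integrable (fun x => a x * b x) ∧
    ∫ x, ‖a x * b x‖ ≤ (eLpNorm a 2 volume).toReal * (eLpNorm b 2 volume).toReal := by
  have hi : Integrable (fun x => a x * b x) := ha.integrable_mul hb
  refine ⟨hi, ?_⟩
  have h := eLpNorm_smul_le_mul_eLpNorm (p := 2) (q := 2) (r := 1) hb.1 ha.1
  rw [integral_norm_eq_lintegral_enorm hi.1, ← ENNReal.toReal_mul]
  refine ENNReal.toReal_mono (ENNReal.mul_ne_top ha.2.ne hb.2.ne) ?_
  rw [eLpNorm_one_eq_lintegral_enorm] at h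
  exact h

/-! ### The frequency-truncated kernel -/

/-- The square of frequencies (dual to `∂_j ↔ i ξ_j`) with both coordinates at most `Λ`. -/
def freqBox (Λ : ℝ) : Set Plane := {ξ | ∀ j, |2 * Real.pi * ξ j| ≤ Λ}

theorem measurableSet_freqBox (Λ : ℝ) : MeasurableSet (freqBox Λ) := by
  simp only [freqBox, ofPred_forall]
  exact MeasurableSet.iInter fun j => measurableSet_le (by fun_prop) (by fun_prop)

/-- The kernel of a frequency-truncated multiplier with a product symbol factorises. -/
theorem norm_fourierInv_freqBox_le {Λ : ℝ} (hΛ : 0 ≤ Λ) (t : ℝ) {m : Plane → ℂ}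
    {μ : Fin 2 → ℝ → ℂ} (hm : ∀ ξ, m ξ = μ 0 (2 * Real.pi * ξ 0) * μ 1 (2 * Real.pi * ξ 1))
    (z : Plane) :
    ‖𝓕⁻ ((freqBox Λ).indicator fun ξ => m ξ * kernelSymbol t ξ) z‖ ≤
      ∏ j, ‖∫ η in (-Λ)..Λ, μ j η * Complex.exp (Complex.I * ((z j * η + t * η ^ 3 : ℝ) : ℂ))‖ := by
  set ψ : Fin 2 → ℝ → ℂ := fun j => (Icc (-Λ) Λ).indicator fun η =>
    μ j η * Complex.exp (Complex.I * ((z j * η + t * η ^ 3 : ℝ) : ℂ)) with hψ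
  have hpt : ∀ ξ : Plane, Complex.exp (↑(2 * Real.pi * inner ℝ ξ z) * Complex.I) •
      (freqBox Λ).indicator (fun ξ => m ξ * kernelSymbol t ξ) ξ =
      ∏ j, ψ j (2 * Real.pi * ξ j) := by
    intro ξ
    by_cases hξ : ξ ∈ freqBox Λ
    · have h0 := hξ 0
      have h1 := hξ 1
      rw [abs_le] at h0 h1
      simp only [hψ]
      rw [Fin.prod_univ_two, indicator_of_mem hξ, indicator_of_mem (s := Icc (-Λ) Λ) h0,
        indicator_of_mem (s := Icc (-Λ) Λ) h1, hm,
        kernelSymbol, smul_eq_mul]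
      have hexp : Complex.exp (↑(2 * Real.pi * inner ℝ ξ z) * Complex.I) *
          Complex.exp (Complex.I *
            (t * ((2 * Real.pi * ξ 0) ^ 3 + (2 * Real.pi * ξ 1) ^ 3) : ℝ)) =
          Complex.exp (Complex.I *
            ((z 0 * (2 * Real.pi * ξ 0) + t * (2 * Real.pi * ξ 0) ^ 3 : ℝ) : ℂ)) *
          Complex.exp (Complex.I *
            ((z 1 * (2 * Real.pi * ξ 1) + t * (2 * Real.pi * ξ 1) ^ 3 : ℝ) : ℂ)) := by
        rw [← Complex.exp_add, ← Complex.exp_add]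
        congr 1
        have : inner ℝ ξ z = ξ 0 * z 0 + ξ 1 * z 1 := by
          simp [PiLp.inner_apply, Fin.sum_univ_two, mul_comm]
        rw [this]; push_cast; ring
      linear_combination (μ 0 (2 * Real.pi * ξ 0) * μ 1 (2 * Real.pi * ξ 1)) * hexp
    · rw [indicator_of_notMem hξ, smul_zero]
      have : ∃ j, ¬ |2 * Real.pi * ξ j| ≤ Λ := not_forall.1 hξ
      obtain ⟨j, hj⟩ := this
      have hj' : 2 * Real.pi * ξ j ∉ Icc (-Λ) Λ := fun h => hj (abs_le.2 (mem_Icc.1 h))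
      exact (Finset.prod_eq_zero (Finset.mem_univ j)
        (indicator_of_notMem (s := Icc (-Λ) Λ) hj' _)).symm
  have hint : 𝓕⁻ ((freqBox Λ).indicator fun ξ => m ξ * kernelSymbol t ξ) z =
      ∏ j, ∫ s : ℝ, ψ j (2 * Real.pi * s) := by
    rw [Real.fourierInv_eq', integral_congr_ae (.of_forall hpt),
      ← integral_fintype_prod_volume_eq_prod (fun j s => ψ j (2 * Real.pi * s))]
    exact (PiLp.volume_preserving_ofLp (Fin 2)).integral_comp
      (MeasurableEquiv.toLp 2 (Fin 2 → ℝ)).symm.measurableEmbedding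
      (fun x : Fin 2 → ℝ => ∏ j, ψ j (2 * Real.pi * x j))
  rw [hint, norm_prod]
  refine Finset.prod_le_prod (fun j _ => norm_nonneg _) fun j _ => ?_
  rw [Measure.integral_comp_mul_left (ψ j), norm_smul, integral_indicator measurableSet_Icc,
    integral_Icc_eq_integral_Ioc, ← intervalIntegral.integral_of_le (by linarith)]
  refine mul_le_of_le_one_left (norm_nonneg _) ?_
  rw [norm_abs_eq_norm, Real.norm_eq_abs, abs_inv, abs_of_pos Real.two_pi_pos]
  exact inv_le_one_of_one_le₀ (by linarith [Real.two_le_pi])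

/-! ### Weighted bounds for the solution and its profile -/

theorem eLpNorm_fourier (h : L2) :
    eLpNorm (𝓕 h : L2) 2 (volume : Measure Plane) = eLpNorm h 2 volume := by
  rw [← Lp.enorm_def, ← Lp.enorm_def, ← ofReal_norm, ← ofReal_norm, Lp.norm_fourier_eq]

theorem norm_kernelSymbol (t : ℝ) (ξ : Plane) : ‖kernelSymbol t ξ‖ = 1 := by
  rw [kernelSymbol, mul_comm Complex.I, Complex.norm_exp_ofReal_mul_I]

theorem measurable_kernelSymbol (t : ℝ) : Measurable (kernelSymbol t) := by
  unfold kernelSymbol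
  fun_prop

theorem kernelSymbol_mul_neg (t : ℝ) (ξ : Plane) : kernelSymbol t ξ * kernelSymbol (-t) ξ = 1 := by
  rw [kernelSymbol, kernelSymbol, ← Complex.exp_add, ← Complex.exp_zero]
  congr 1; push_cast; ring

theorem eLpNorm_linearFlow (t : ℝ) (g : L2) :
    eLpNorm (linearFlow t g) 2 volume = eLpNorm g 2 volume := by
  rw [← eLpNorm_fourier, ← eLpNorm_fourier g]
  refine eLpNorm_congr_norm_ae ?_
  filter_upwards [fourier_fourierMultiplier (inDomain_kernelSymbol t g)] with ξ hξ
  rw [linearFlow, hξ, norm_mul, norm_kernelSymbol, one_mul]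

theorem fourier_eq_kernelSymbol_mul (t : ℝ) (g : L2) :
    ((𝓕 g : L2) : Plane → ℂ) =ᵐ[volume]
      fun ξ => kernelSymbol t ξ * (𝓕 (linearFlow (-t) g) : L2) ξ := by
  filter_upwards [fourier_fourierMultiplier (inDomain_kernelSymbol (-t) g)] with ξ hξ
  rw [linearFlow, hξ, ← mul_assoc, kernelSymbol_mul_neg, one_mul]

theorem eLpNorm_le_H3norm (g : L2) : eLpNorm g 2 volume ≤ H3norm g := by
  rw [← eLpNorm_fourier, H3norm]
  refine eLpNorm_mono fun ξ => ?_
  rw [norm_mul, Complex.norm_real, Real.norm_of_nonneg (by positivity)]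
  refine le_mul_of_one_le_left (norm_nonneg _) (Real.one_le_rpow ?_ (by norm_num))
  linarith [sq_nonneg ‖(2 * Real.pi) • ξ‖]

/-- The weight `(1 + |x|²)^{-(1 + δ)/2}`, square integrable on the plane for `δ > 0`. -/
def decayWeight (δ : ℝ) (x : Plane) : ℂ := (((1 + ‖x‖ ^ 2) ^ (-(1 + δ) / 2) : ℝ) : ℂ)

theorem norm_decayWeight (δ : ℝ) (x : Plane) :
    ‖decayWeight δ x‖ = (1 + ‖x‖ ^ 2) ^ (-(1 + δ) / 2) := by
  rw [decayWeight, Complex.norm_real, Real.norm_of_nonneg (by positivity)]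

theorem memLp_decayWeight {δ : ℝ} (hδ : 0 < δ) : MemLp (decayWeight δ) 2 volume := by
  have hm : Measurable (decayWeight δ) := by unfold decayWeight; fun_prop
  rw [memLp_two_iff_integrable_sq_norm hm.aestronglyMeasurable]
  have h := integrable_rpow_neg_one_add_norm_sq (E := Plane) (μ := volume) (r := 2 + 2 * δ)
    (by simp; linarith)
  refine h.congr (.of_forall fun x => ?_)
  simp only [norm_decayWeight]
  rw [← Real.rpow_natCast ((1 + ‖x‖ ^ 2) ^ (-(1 + δ) / 2)) 2, ← Real.rpow_mul (by positivity)]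
  congr 1; push_cast; ring

/-- The constant `‖(1 + |x|²)^{-(1 + δ)/2}‖_{L²}`. -/
def decayConst (δ : ℝ) : ℝ := (eLpNorm (decayWeight δ) 2 volume).toReal

theorem decayConst_nonneg (δ : ℝ) : 0 ≤ decayConst δ := ENNReal.toReal_nonneg

theorem norm_le_norm_two_pi_smul (ξ : Plane) : ‖ξ‖ ≤ ‖(2 * Real.pi) • ξ‖ := by
  rw [norm_smul, Real.norm_of_nonneg Real.two_pi_pos.le]
  exact le_mul_of_one_le_left (norm_nonneg _) (by linarith [Real.two_le_pi])

/-- A symbol of order `r` is split into the small factor `Λ^{r - 2 + δ}`, a square integrable weight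
and the weight of the `H³` norm. -/
theorem rpow_norm_le_decay {δ r Λ : ℝ} (hδ : 0 ≤ δ) (hr : 0 ≤ r) (hrδ : r - 2 + δ ≤ 0)
    (hΛ : 1 ≤ Λ) {ξ : Plane} (hξ : Λ ^ 2 ≤ 1 + ‖(2 * Real.pi) • ξ‖ ^ 2) :
    ‖(2 * Real.pi) • ξ‖ ^ r ≤ Λ ^ (r - 2 + δ) *
      ((1 + ‖ξ‖ ^ 2) ^ (-(1 + δ) / 2) * (1 + ‖(2 * Real.pi) • ξ‖ ^ 2) ^ (3 / 2 : ℝ)) := by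
  set N := ‖(2 * Real.pi) • ξ‖
  have hN : 0 ≤ N := norm_nonneg _
  have hn : 0 < 1 + N ^ 2 := by positivity
  have e1 : N ^ r = (N ^ 2) ^ (r / 2) := by
    rw [← Real.rpow_natCast, ← Real.rpow_mul hN]; congr 1; push_cast; ring
  have e2 : Λ ^ (r - 2 + δ) = (Λ ^ 2) ^ ((r - 2 + δ) / 2) := by
    rw [← Real.rpow_natCast, ← Real.rpow_mul (by linarith)]; congr 1; push_cast; ring
  have h1 : (1 + N ^ 2) ^ ((r - 2 + δ) / 2) ≤ (Λ ^ 2) ^ ((r - 2 + δ) / 2) :=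
    Real.rpow_le_rpow_of_nonpos (by positivity) hξ (by linarith)
  have h2 : (1 + N ^ 2) ^ (-(1 + δ) / 2) ≤ (1 + ‖ξ‖ ^ 2) ^ (-(1 + δ) / 2) := by
    refine Real.rpow_le_rpow_of_nonpos (by positivity) ?_ (by linarith)
    have := pow_le_pow_left₀ (norm_nonneg ξ) (norm_le_norm_two_pi_smul ξ) 2
    linarith
  calc N ^ r = (N ^ 2) ^ (r / 2) := e1
    _ ≤ (1 + N ^ 2) ^ (r / 2) := Real.rpow_le_rpow (by positivity) (by linarith) (by linarith)
    _ = (1 + N ^ 2) ^ ((r - 2 + δ) / 2) *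
        ((1 + N ^ 2) ^ (-(1 + δ) / 2) * (1 + N ^ 2) ^ (3 / 2 : ℝ)) := by
      rw [← Real.rpow_add hn, ← Real.rpow_add hn]; congr 1; ring
    _ ≤ _ := by
      rw [e2]
      gcongr

theorem sq_le_of_notMem_freqBox {Λ : ℝ} (hΛ : 0 ≤ Λ) {ξ : Plane} (hξ : ξ ∉ freqBox Λ) :
    Λ ^ 2 ≤ 1 + ‖(2 * Real.pi) • ξ‖ ^ 2 := by
  obtain ⟨j, hj⟩ : ∃ j, ¬ |2 * Real.pi * ξ j| ≤ Λ := not_forall.1 hξ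
  have h1 := coord_sq_le j ξ
  have h2 := pow_le_pow_left₀ hΛ (not_le.1 hj).le 2
  rw [sq_abs] at h2
  linarith

/-- High frequencies: only the `H³` norm is needed. -/
theorem integral_norm_symbol_mul_fourier_le {δ r A : ℝ} (hδ : 0 < δ) (hr : 0 ≤ r)
    (hrδ : r - 2 + δ ≤ 0) (hA : 0 ≤ A) {m : Plane → ℂ} (hm : Measurable m)
    (hmr : ∀ ξ, ‖m ξ‖ ≤ ‖(2 * Real.pi) • ξ‖ ^ r) {g : L2} (hg : H3norm g ≤ ENNReal.ofReal A) :
    Integrable (fun ξ => m ξ * (𝓕 g : L2) ξ) ∧ ∀ Λ, 1 ≤ Λ →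
      ∫ ξ, ‖(freqBox Λ)ᶜ.indicator (fun ξ => m ξ * (𝓕 g : L2) ξ) ξ‖ ≤
        Λ ^ (r - 2 + δ) * (decayConst δ * A) := by
  set U : Plane → ℂ := fun ξ =>
    (((1 + ‖(2 * Real.pi) • ξ‖ ^ 2) ^ (3 / 2 : ℝ) : ℝ) : ℂ) * (𝓕 g : L2) ξ with hU
  have hUm : AEStronglyMeasurable U volume :=
    (Measurable.aestronglyMeasurable (by fun_prop)).mul (Lp.aestronglyMeasurable _)
  have hU2 : MemLp U 2 := ⟨hUm, hg.trans_lt ENNReal.ofReal_lt_top⟩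
  obtain ⟨hi, hle⟩ := integral_norm_mul_le_of_memLp_two (memLp_decayWeight hδ) hU2
  have hUA : (eLpNorm U 2 volume).toReal ≤ A := ENNReal.toReal_le_of_le_ofReal hA hg
  have hpt : ∀ Λ ξ, 1 ≤ Λ → Λ ^ 2 ≤ 1 + ‖(2 * Real.pi) • ξ‖ ^ 2 →
      ‖m ξ * (𝓕 g : L2) ξ‖ ≤ Λ ^ (r - 2 + δ) * ‖decayWeight δ ξ * U ξ‖ := by
    intro Λ ξ hΛ hξ
    rw [norm_mul, norm_mul, norm_decayWeight, hU, norm_mul, Complex.norm_real,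
      Real.norm_of_nonneg (by positivity), ← mul_assoc, ← mul_assoc]
    refine mul_le_mul_of_nonneg_right ((hmr ξ).trans ?_) (norm_nonneg _)
    rw [mul_assoc]
    exact rpow_norm_le_decay hδ.le hr hrδ hΛ hξ
  have hhm : AEStronglyMeasurable (fun ξ => m ξ * (𝓕 g : L2) ξ) volume :=
    hm.aestronglyMeasurable.mul (Lp.aestronglyMeasurable _)
  have hint : Integrable (fun ξ => m ξ * (𝓕 g : L2) ξ) := by
    -- with `Λ = 1` the pointwise bound holds at every frequency
    refine (hi.norm.const_mul (1 ^ (r - 2 + δ))).mono' hhm (.of_forall fun ξ => ?_)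
    exact hpt 1 ξ le_rfl (by nlinarith [sq_nonneg ‖(2 * Real.pi) • ξ‖])
  refine ⟨hint, fun Λ hΛ => ?_⟩
  have hΛ0 : 0 ≤ Λ ^ (r - 2 + δ) := Real.rpow_nonneg (by linarith) _
  calc ∫ ξ, ‖(freqBox Λ)ᶜ.indicator (fun ξ => m ξ * (𝓕 g : L2) ξ) ξ‖
      ≤ ∫ ξ, Λ ^ (r - 2 + δ) * ‖decayWeight δ ξ * U ξ‖ := by
        refine integral_mono (hint.indicator (measurableSet_freqBox Λ).compl).norm
          (hi.norm.const_mul _) fun ξ => ?_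
        by_cases hξ : ξ ∈ freqBox Λ
        · simp only [indicator_of_notMem (notMem_compl_iff.2 hξ), norm_zero]
          positivity
        · simp only [indicator_of_mem (mem_compl hξ)]
          exact hpt Λ ξ hΛ (sq_le_of_notMem_freqBox (by linarith) hξ)
    _ = Λ ^ (r - 2 + δ) * ∫ ξ, ‖decayWeight δ ξ * U ξ‖ := integral_const_mul _ _
    _ ≤ _ := by
        gcongr
        exact hle.trans (mul_le_mul_of_nonneg_left hUA ENNReal.toReal_nonneg)

/-- The function `(1 + |x_a| + |x_b|) f`. -/
def spatialWeight (f : Plane → ℂ) (x : Plane) : ℂ := ((1 + |x 0| + |x 1| : ℝ) : ℂ) * f x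

theorem norm_spatialWeight (f : Plane → ℂ) (x : Plane) :
    ‖spatialWeight f x‖ = (1 + |x 0| + |x 1|) * ‖f x‖ := by
  rw [spatialWeight, norm_mul, Complex.norm_real, Real.norm_of_nonneg (by positivity)]

theorem memLp_spatialWeight {f : L2} {A : ℝ} (hA : 0 ≤ A)
    (h : eLpNorm f 2 volume ≤ ENNReal.ofReal A)
    (h0 : eLpNorm (fun x : Plane => ((x 0 : ℝ) : ℂ) * f x) 2 volume ≤ ENNReal.ofReal A)
    (h1 : eLpNorm (fun x : Plane => ((x 1 : ℝ) : ℂ) * f x) 2 volume ≤ ENNReal.ofReal A) :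
    MemLp (spatialWeight f) 2 ∧
      eLpNorm (spatialWeight f) 2 volume ≤ ENNReal.ofReal (3 * A) := by
  have hc : ∀ j : Fin 2, eLpNorm (fun x : Plane => ((|x j| : ℝ) : ℂ) * f x) 2 volume =
      eLpNorm (fun x : Plane => ((x j : ℝ) : ℂ) * f x) 2 volume := fun j =>
    eLpNorm_congr_norm_ae (.of_forall fun x => by simp)
  have hmeas : ∀ j : Fin 2, AEStronglyMeasurable (fun x : Plane => ((|x j| : ℝ) : ℂ) * f x)
      volume := fun j =>
    (Measurable.aestronglyMeasurable (by fun_prop)).mul (Lp.aestronglyMeasurable _)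
  have heq : spatialWeight f = ((f : Plane → ℂ) + fun x : Plane => ((|x 0| : ℝ) : ℂ) * f x) +
      fun x : Plane => ((|x 1| : ℝ) : ℂ) * f x := by
    ext x; simp only [spatialWeight, Pi.add_apply]; push_cast; ring
  have hb : eLpNorm (spatialWeight f) 2 volume ≤ ENNReal.ofReal (3 * A) := by
    rw [heq, show 3 * A = A + A + A by ring, ENNReal.ofReal_add (by positivity) hA,
      ENNReal.ofReal_add hA hA]
    refine (eLpNorm_add_le ((Lp.aestronglyMeasurable f).add (hmeas 0)) (hmeas 1)
      (by norm_num)).trans (add_le_add ?_ ((hc 1).trans_le h1))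
    exact (eLpNorm_add_le (Lp.aestronglyMeasurable f) (hmeas 0) (by norm_num)).trans
      (add_le_add h ((hc 0).trans_le h0))
  refine ⟨⟨?_, hb.trans_lt ENNReal.ofReal_lt_top⟩, hb⟩
  rw [heq]
  exact ((Lp.aestronglyMeasurable f).add (hmeas 0)).add (hmeas 1)

theorem norm_sq_eq_plane (x : Plane) : ‖x‖ ^ 2 = |x 0| ^ 2 + |x 1| ^ 2 := by
  rw [EuclideanSpace.norm_sq_eq, Fin.sum_univ_two, Real.norm_eq_abs, Real.norm_eq_abs]

theorem norm_le_add_abs (x : Plane) : ‖x‖ ≤ |x 0| + |x 1| := by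
  refine le_of_sq_le_sq ?_ (by positivity)
  rw [norm_sq_eq_plane]
  nlinarith [mul_nonneg (abs_nonneg (x 0)) (abs_nonneg (x 1))]

/-- The part of the profile in a ball is integrable, with a norm that grows slower than any
power of the radius. -/
theorem integral_norm_indicator_ball_le {δ A R : ℝ} (hδ : 0 < δ) (hA : 0 ≤ A) {f : L2}
    (hf : MemLp (spatialWeight f) 2)
    (hfA : eLpNorm (spatialWeight f) 2 volume ≤ ENNReal.ofReal (3 * A)) :
    Integrable ((Metric.closedBall (0 : Plane) R).indicator f) ∧
    ∫ x, ‖(Metric.closedBall (0 : Plane) R).indicator f x‖ ≤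
      (1 + R ^ 2) ^ (δ / 2) * (decayConst δ * (3 * A)) := by
  obtain ⟨hi, hle⟩ := integral_norm_mul_le_of_memLp_two (memLp_decayWeight hδ) hf
  have hUA := ENNReal.toReal_le_of_le_ofReal (by positivity : 0 ≤ 3 * A) hfA
  have hpt : ∀ x, ‖(Metric.closedBall (0 : Plane) R).indicator f x‖ ≤
      (1 + R ^ 2) ^ (δ / 2) * ‖decayWeight δ x * spatialWeight f x‖ := by
    intro x
    by_cases hx : x ∈ Metric.closedBall (0 : Plane) R
    · rw [indicator_of_mem hx, norm_mul, norm_decayWeight, norm_spatialWeight, ← mul_assoc,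
        ← mul_assoc]
      refine le_mul_of_one_le_left (norm_nonneg _) ?_
      rw [mem_closedBall_zero_iff] at hx
      have hn : 0 < 1 + ‖x‖ ^ 2 := by positivity
      have h1 : (1 + ‖x‖ ^ 2) ^ (1 / 2 : ℝ) ≤ 1 + |x 0| + |x 1| := by
        rw [← Real.sqrt_eq_rpow, Real.sqrt_le_left (by positivity), norm_sq_eq_plane]
        nlinarith [mul_nonneg (abs_nonneg (x 0)) (abs_nonneg (x 1)), abs_nonneg (x 0),
          abs_nonneg (x 1)]
      have h2 : (1 + ‖x‖ ^ 2) ^ (δ / 2) ≤ (1 + R ^ 2) ^ (δ / 2) := by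
        gcongr
      calc (1 : ℝ) = (1 + ‖x‖ ^ 2) ^ (δ / 2) * (1 + ‖x‖ ^ 2) ^ (-(1 + δ) / 2) *
            (1 + ‖x‖ ^ 2) ^ (1 / 2 : ℝ) := by
            rw [← Real.rpow_add hn, ← Real.rpow_add hn]
            ring_nf
            simp
        _ ≤ _ := by gcongr
    · rw [indicator_of_notMem hx, norm_zero]
      positivity
  have hm : AEStronglyMeasurable ((Metric.closedBall (0 : Plane) R).indicator f) volume :=
    (Lp.aestronglyMeasurable f).indicator measurableSet_closedBall
  have hint := (hi.norm.const_mul ((1 + R ^ 2) ^ (δ / 2))).mono' hm (.of_forall hpt)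
  refine ⟨hint, (integral_mono hint.norm (hi.norm.const_mul _) hpt).trans ?_⟩
  rw [integral_const_mul]
  gcongr
  exact hle.trans (mul_le_mul_of_nonneg_left hUA ENNReal.toReal_nonneg)

/-- The part of the profile outside a ball is small in `L²`. -/
theorem eLpNorm_indicator_compl_ball_le {A R : ℝ} (hR : 0 < R) {f : L2}
    (hfA : eLpNorm (spatialWeight f) 2 volume ≤ ENNReal.ofReal (3 * A)) :
    eLpNorm ((Metric.closedBall (0 : Plane) R)ᶜ.indicator f) 2 volume ≤
      ENNReal.ofReal (R⁻¹ * (3 * A)) := by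
  refine (eLpNorm_le_mul_eLpNorm_of_ae_le_mul (c := R⁻¹) (.of_forall fun x => ?_) 2).trans
    ((mul_le_mul_right hfA _).trans_eq (ENNReal.ofReal_mul (inv_nonneg.2 hR.le)).symm)
  by_cases hx : x ∈ Metric.closedBall (0 : Plane) R
  · rw [indicator_of_notMem (notMem_compl_iff.2 hx), norm_zero]; positivity
  · rw [indicator_of_mem (mem_compl hx), norm_spatialWeight, ← mul_assoc]
    refine le_mul_of_one_le_left (norm_nonneg _) ?_
    rw [mem_closedBall_zero_iff, not_le] at hx
    rw [inv_mul_eq_div, one_le_div hR]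
    linarith [norm_le_add_abs x]

theorem freqBox_subset_closedBall (Λ : ℝ) :
    freqBox Λ ⊆ Metric.closedBall 0 Λ := by
  intro ξ hξ
  rw [mem_closedBall_zero_iff]
  have h : ∀ j, 2 * |ξ j| ≤ Λ := fun j => by
    refine le_trans ?_ (hξ j)
    rw [abs_mul, abs_of_pos Real.two_pi_pos]
    gcongr
    linarith [Real.two_le_pi]
  linarith [norm_le_add_abs ξ, h 0, h 1]

theorem norm_two_pi_smul_le_of_mem_freqBox {Λ : ℝ} {ξ : Plane} (hξ : ξ ∈ freqBox Λ) :
    ‖(2 * Real.pi) • ξ‖ ≤ 2 * Λ := by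
  have h := norm_le_add_abs ((2 * Real.pi) • ξ)
  simp only [PiLp.smul_apply, smul_eq_mul] at h
  linarith [hξ 0, hξ 1]

/-- A crude `L²` bound on truncated symbols of order at most one. -/
theorem eLpNorm_indicator_freqBox_le {r Λ : ℝ} (hr : 0 ≤ r) (hr1 : r ≤ 1) (hΛ : 1 ≤ Λ)
    {m : Plane → ℂ} (hmr : ∀ ξ, ‖m ξ‖ ≤ ‖(2 * Real.pi) • ξ‖ ^ r) :
    eLpNorm ((freqBox Λ).indicator m) 2 volume ≤ ENNReal.ofReal (4 * Λ ^ 2) := by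
  have h1 : eLpNorm ((freqBox Λ).indicator m) 2 volume ≤
      eLpNorm ((Metric.closedBall (0 : Plane) Λ).indicator fun _ => (2 * Λ : ℝ)) 2 volume := by
    refine eLpNorm_mono fun ξ => ?_
    by_cases hξ : ξ ∈ freqBox Λ
    · rw [indicator_of_mem hξ, indicator_of_mem (freqBox_subset_closedBall Λ hξ),
        Real.norm_of_nonneg (by linarith)]
      calc ‖m ξ‖ ≤ ‖(2 * Real.pi) • ξ‖ ^ r := hmr ξ
        _ ≤ (2 * Λ) ^ r :=
          Real.rpow_le_rpow (norm_nonneg _) (norm_two_pi_smul_le_of_mem_freqBox hξ) hr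
        _ ≤ (2 * Λ) ^ (1 : ℝ) := Real.rpow_le_rpow_of_exponent_le (by linarith) hr1
        _ = 2 * Λ := Real.rpow_one _
    · rw [indicator_of_notMem hξ, norm_zero]; positivity
  refine h1.trans ?_
  rw [eLpNorm_indicator_const measurableSet_closedBall (by norm_num) (by norm_num),
    EuclideanSpace.volume_closedBall_fin_two]
  have h2 : (ENNReal.ofReal Λ ^ 2 * ENNReal.ofReal Real.pi : ℝ≥0∞) ≤
      ENNReal.ofReal (2 * Λ) ^ 2 := by
    rw [← ENNReal.ofReal_pow (by linarith), ← ENNReal.ofReal_mul (by positivity),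
      ← ENNReal.ofReal_pow (by linarith)]
    refine ENNReal.ofReal_le_ofReal ?_
    nlinarith [Real.pi_le_four, sq_nonneg Λ]
  calc ‖2 * Λ‖ₑ * (ENNReal.ofReal Λ ^ 2 * ENNReal.ofReal Real.pi) ^ (1 / (2 : ℝ≥0∞).toReal)
      ≤ ‖2 * Λ‖ₑ * (ENNReal.ofReal (2 * Λ) ^ 2) ^ (1 / (2 : ℝ≥0∞).toReal) := by gcongr
    _ = ENNReal.ofReal (2 * Λ) * ENNReal.ofReal (2 * Λ) := by
      rw [Real.enorm_eq_ofReal (by linarith), ← ENNReal.rpow_natCast, ← ENNReal.rpow_mul]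
      norm_num
    _ = ENNReal.ofReal (4 * Λ ^ 2) := by
      rw [← ENNReal.ofReal_mul (by linarith)]; congr 1; ring

/-! ### The dispersive estimate -/

/-- The dispersive estimate with free truncation parameters: `Λ` in frequency, `R` in space. -/
theorem ae_norm_fourierMultiplier_le {δ r A B t Λ R : ℝ} (hδ : 0 < δ) (hr : 0 ≤ r) (hr1 : r ≤ 1)
    (hrδ : r - 2 + δ ≤ 0) (hA : 0 ≤ A) (hΛ : 1 ≤ Λ) (hR : 0 < R) {m : Plane → ℂ}
    (hm : Measurable m) (hmr : ∀ ξ, ‖m ξ‖ ≤ ‖(2 * Real.pi) • ξ‖ ^ r) (hB0 : 0 ≤ B)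
    (hB : ∀ z, ‖𝓕⁻ ((freqBox Λ).indicator fun ξ => m ξ * kernelSymbol t ξ) z‖ ≤ B)
    {g : L2} (hg : H3norm g ≤ ENNReal.ofReal A)
    (h0 : eLpNorm (fun x : Plane => ((x 0 : ℝ) : ℂ) * linearFlow (-t) g x) 2 volume
      ≤ ENNReal.ofReal A)
    (h1 : eLpNorm (fun x : Plane => ((x 1 : ℝ) : ℂ) * linearFlow (-t) g x) 2 volume
      ≤ ENNReal.ofReal A) :
    ∀ᵐ x, ‖fourierMultiplier m g x‖ ≤
      B * ((1 + R ^ 2) ^ (δ / 2) * (decayConst δ * (3 * A))) + 4 * Λ ^ 2 * (R⁻¹ * (3 * A)) +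
        Λ ^ (r - 2 + δ) * (decayConst δ * A) := by
  set f : L2 := linearFlow (-t) g with hf
  obtain ⟨hi, hhigh⟩ := integral_norm_symbol_mul_fourier_le hδ hr hrδ hA hm hmr hg
  obtain ⟨hV, hVA⟩ := memLp_spatialWeight hA
    ((eLpNorm_linearFlow (-t) g).trans_le ((eLpNorm_le_H3norm g).trans hg)) h0 h1
  obtain ⟨hF1, hF1A⟩ := integral_norm_indicator_ball_le (R := R) hδ hA hV hVA
  have hF2A := eLpNorm_indicator_compl_ball_le hR hVA
  set h : Plane → ℂ := fun ξ => m ξ * (𝓕 g : L2) ξ with hh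
  have hdom : InDomain m g := by
    refine inDomain_of_le hm (fun ξ => (hmr ξ).trans ?_) (hg.trans_lt ENNReal.ofReal_lt_top)
    set N := ‖(2 * Real.pi) • ξ‖
    have hN : 0 ≤ N := norm_nonneg _
    calc N ^ r = (N ^ 2) ^ (r / 2) := by
          rw [← Real.rpow_natCast, ← Real.rpow_mul hN]; congr 1; push_cast; ring
      _ ≤ (1 + N ^ 2) ^ (r / 2) := Real.rpow_le_rpow (by positivity) (by linarith) (by linarith)
      _ ≤ (1 + N ^ 2) ^ (3 / 2 : ℝ) :=
        Real.rpow_le_rpow_of_exponent_le (by nlinarith) (by linarith)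
  have hinv : (fourierMultiplier m g : Plane → ℂ) =ᵐ[volume] 𝓕⁻ h := by
    rw [fourierMultiplier, dif_pos hdom]
    have hco : ((MemLp.toLp _ hdom : L2) : Plane → ℂ) =ᵐ[volume] h := MemLp.coeFn_toLp hdom
    filter_upwards [coeFn_fourierInv_ae_eq ((integrable_congr hco).2 hi)] with x hx
    rw [hx]
    exact Real.fourierInv_congr_ae hco x
  -- the profile is split into an integrable piece and a piece that is small in `L²`
  set ball := Metric.closedBall (0 : Plane) R with hball
  have hF1mem : MemLp (ball.indicator f) 2 := (Lp.memLp f).indicator measurableSet_closedBall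
  set f₁ : L2 := hF1mem.toLp _ with hf₁
  have hf₁co : (f₁ : Plane → ℂ) =ᵐ[volume] ball.indicator f := MemLp.coeFn_toLp hF1mem
  set f₂ : L2 := f - f₁ with hf₂
  have hf₂co : (f₂ : Plane → ℂ) =ᵐ[volume] ballᶜ.indicator f := by
    filter_upwards [Lp.coeFn_sub f f₁, hf₁co] with x hx hx1
    rw [hf₂, hx, Pi.sub_apply, hx1, indicator_compl, Pi.sub_apply]
  have hfsplit : ((𝓕 f : L2) : Plane → ℂ) =ᵐ[volume]
      fun ξ => 𝓕 (ball.indicator f) ξ + (𝓕 f₂ : L2) ξ := by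
    have e : (𝓕 f : L2) = 𝓕 f₁ + 𝓕 f₂ := by
      rw [← FourierTransform.fourier_add, hf₂, add_sub_cancel]
    filter_upwards [Lp.coeFn_add (𝓕 f₁ : L2) (𝓕 f₂),
      coeFn_fourier_ae_eq ((integrable_congr hf₁co).2 hF1)] with ξ hξ hξ1
    rw [e, hξ, Pi.add_apply, hξ1, Real.fourier_congr_ae hf₁co]
  set G : Plane → ℂ := (freqBox Λ).indicator fun ξ => m ξ * kernelSymbol t ξ with hG
  have hbox := measurableSet_freqBox Λ
  have hGm : Measurable G := (hm.mul (measurable_kernelSymbol t)).indicator hbox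
  have hmK : ∀ ξ, ‖m ξ * kernelSymbol t ξ‖ ≤ ‖(2 * Real.pi) • ξ‖ ^ r := fun ξ => by
    rw [norm_mul, norm_kernelSymbol, mul_one]; exact hmr ξ
  have hGA : eLpNorm G 2 volume ≤ ENNReal.ofReal (4 * Λ ^ 2) :=
    eLpNorm_indicator_freqBox_le hr hr1 hΛ hmK
  have hG2 : MemLp G 2 := ⟨hGm.aestronglyMeasurable, hGA.trans_lt ENNReal.ofReal_lt_top⟩
  have hGi : Integrable G := by
    rw [hG, integrable_indicator_iff hbox]
    have hfin : volume (freqBox Λ) < ∞ :=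
      (measure_mono (freqBox_subset_closedBall Λ)).trans_lt measure_closedBall_lt_top
    refine Measure.integrableOn_of_bounded (M := (2 * Λ) ^ r) hfin.ne
      (hm.mul (measurable_kernelSymbol t)).aestronglyMeasurable ?_
    filter_upwards [ae_restrict_mem hbox] with ξ hξ
    exact (hmK ξ).trans
      (Real.rpow_le_rpow (norm_nonneg _) (norm_two_pi_smul_le_of_mem_freqBox hξ) hr)
  have hf₂A : eLpNorm (𝓕 f₂ : L2) 2 volume ≤ ENNReal.ofReal (R⁻¹ * (3 * A)) := by
    rw [eLpNorm_fourier, eLpNorm_congr_ae hf₂co]; exact hF2A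
  obtain ⟨hi2, hle2⟩ := integral_norm_mul_le_of_memLp_two hG2 (Lp.memLp (𝓕 f₂ : L2))
  have hlow2 : ∫ ξ, ‖G ξ * (𝓕 f₂ : L2) ξ‖ ≤ 4 * Λ ^ 2 * (R⁻¹ * (3 * A)) :=
    hle2.trans (mul_le_mul (ENNReal.toReal_le_of_le_ofReal (by positivity) hGA)
      (ENNReal.toReal_le_of_le_ofReal (by positivity) hf₂A) ENNReal.toReal_nonneg (by positivity))
  have hi1 : Integrable fun ξ => G ξ * 𝓕 (ball.indicator f) ξ := by
    refine hGi.mul_bdd (c := ∫ x, ‖ball.indicator f x‖)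
      (continuous_fourier_of_integrable hF1).aestronglyMeasurable (.of_forall fun ξ => ?_)
    exact VectorFourier.norm_fourierIntegral_le_integral_norm _ _ _ _ ξ
  have hlow : (freqBox Λ).indicator h =ᵐ[volume]
      fun ξ => G ξ * 𝓕 (ball.indicator f) ξ + G ξ * (𝓕 f₂ : L2) ξ := by
    filter_upwards [fourier_eq_kernelSymbol_mul t g, hfsplit] with ξ hξ hξ2
    by_cases hm : ξ ∈ freqBox Λ
    · rw [hG, indicator_of_mem hm, indicator_of_mem hm, hh]
      simp only
      rw [hξ, ← hf, hξ2]; ring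
    · rw [hG, indicator_of_notMem hm, indicator_of_notMem hm]; simp
  filter_upwards [hinv] with x hx
  have hsplit : 𝓕⁻ h x = 𝓕⁻ (fun ξ => G ξ * 𝓕 (ball.indicator f) ξ) x +
      𝓕⁻ (fun ξ => G ξ * (𝓕 f₂ : L2) ξ) x + 𝓕⁻ ((freqBox Λ)ᶜ.indicator h) x := by
    rw [← fourierInv_add_of_integrable hi1 hi2, ← Real.fourierInv_congr_ae hlow,
      ← fourierInv_add_of_integrable (hi.indicator hbox) (hi.indicator hbox.compl)]
    exact congrArg (fun F : Plane → ℂ => (𝓕⁻ F : Plane → ℂ) x)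
      (indicator_self_add_compl (freqBox Λ) h).symm
  rw [hx, hsplit]
  refine (norm_add₃_le).trans (add_le_add (add_le_add ?_ ?_) ?_)
  · exact (norm_fourierInv_mul_fourier_le hF1 hGi hB x).trans
      (mul_le_mul_of_nonneg_left hF1A hB0)
  · exact (norm_fourierInv_le_integral_norm _ x).trans hlow2
  · exact (norm_fourierInv_le_integral_norm _ x).trans (hhigh Λ hΛ)

/-- The dispersive estimate with the truncations `Λ = t^{5/9}` and `R = t²`. The exponent `β` of
the claim is limited by the kernel bound, by the high frequencies (`β ≤ (2 - r) 5/9`) and by the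
spatial tail (`β ≤ 8/9`). -/
theorem exists_ae_norm_fourierMultiplier_le {ε : ℝ} (hε : 0 < ε) (hε1 : ε ≤ 1) :
    ∃ C : ℝ, 0 ≤ C ∧ ∀ (t A r β : ℝ) (m : Plane → ℂ) (g : L2), 1 ≤ t → 0 ≤ A → 0 ≤ r → r ≤ 1 →
      β ≤ 5 / 9 * (2 - r) → β ≤ 8 / 9 → Measurable m →
      (∀ ξ, ‖m ξ‖ ≤ ‖(2 * Real.pi) • ξ‖ ^ r) →
      (∀ z, ‖𝓕⁻ ((freqBox (t ^ (5 / 9 : ℝ))).indicator fun ξ => m ξ * kernelSymbol t ξ) z‖ ≤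
        34 ^ 2 * t ^ (-β)) →
      H3norm g ≤ ENNReal.ofReal A →
      eLpNorm (fun x : Plane => ((x 0 : ℝ) : ℂ) * linearFlow (-t) g x) 2 volume
        ≤ ENNReal.ofReal A →
      eLpNorm (fun x : Plane => ((x 1 : ℝ) : ℂ) * linearFlow (-t) g x) 2 volume
        ≤ ENNReal.ofReal A →
      ∀ᵐ x, ‖fourierMultiplier m g x‖ ≤ C * t ^ (-β + ε) * A := by
  set δ := ε / 2 with hδ
  have hδ0 : 0 < δ := by positivity
  have hJ := decayConst_nonneg δ
  refine ⟨34 ^ 2 * (2 * (decayConst δ * 3)) + 12 + decayConst δ, by positivity, ?_⟩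
  intro t A r β m g ht hA hr hr1 hβ1 hβ2 hm hmr hB hg h0 h1
  have ht0 : 0 < t := by linarith
  have hΛ : 1 ≤ t ^ (5 / 9 : ℝ) := Real.one_le_rpow ht (by norm_num)
  filter_upwards [ae_norm_fourierMultiplier_le hδ0 hr hr1 (by linarith) hA hΛ
    (R := t ^ (2 : ℝ)) (by positivity) hm hmr (by positivity) hB hg h0 h1] with x hx
  refine hx.trans ?_
  have e1 : (1 + (t ^ (2 : ℝ)) ^ 2) ^ (δ / 2) ≤ 2 * t ^ ε := by
    have hb : 1 + (t ^ (2 : ℝ)) ^ 2 ≤ 2 * t ^ (4 : ℝ) := by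
      have : (t ^ (2 : ℝ)) ^ 2 = t ^ (4 : ℝ) := by
        rw [← Real.rpow_natCast, ← Real.rpow_mul ht0.le]; norm_num
      have h4 : 1 ≤ t ^ (4 : ℝ) := Real.one_le_rpow ht (by norm_num)
      rw [this]
      linarith
    calc (1 + (t ^ (2 : ℝ)) ^ 2) ^ (δ / 2) ≤ (2 * t ^ (4 : ℝ)) ^ (δ / 2) := by gcongr
      _ = 2 ^ (δ / 2) * t ^ ε := by
        rw [Real.mul_rpow (by norm_num) (by positivity), ← Real.rpow_mul ht0.le]
        congr 2; rw [hδ]; ring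
      _ ≤ 2 ^ (1 : ℝ) * t ^ ε := by
        gcongr
        · norm_num
        · linarith
      _ = 2 * t ^ ε := by rw [Real.rpow_one]
  have e2 : t ^ (-β) * t ^ ε = t ^ (-β + ε) := (Real.rpow_add ht0 _ _).symm
  have e3 : (t ^ (5 / 9 : ℝ)) ^ 2 * (t ^ (2 : ℝ))⁻¹ ≤ t ^ (-β + ε) := by
    rw [← Real.rpow_natCast, ← Real.rpow_mul ht0.le, ← Real.rpow_neg ht0.le, ← Real.rpow_add ht0]
    refine Real.rpow_le_rpow_of_exponent_le ht ?_
    push_cast; linarith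
  have e4 : (t ^ (5 / 9 : ℝ)) ^ (r - 2 + δ) ≤ t ^ (-β + ε) := by
    rw [← Real.rpow_mul ht0.le]
    refine Real.rpow_le_rpow_of_exponent_le ht ?_
    rw [hδ]; linarith
  have k1 : 34 ^ 2 * t ^ (-β) * ((1 + (t ^ (2 : ℝ)) ^ 2) ^ (δ / 2) * (decayConst δ * (3 * A))) ≤
      34 ^ 2 * (2 * (decayConst δ * 3)) * t ^ (-β + ε) * A := by
    calc 34 ^ 2 * t ^ (-β) * ((1 + (t ^ (2 : ℝ)) ^ 2) ^ (δ / 2) * (decayConst δ * (3 * A)))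
        ≤ 34 ^ 2 * t ^ (-β) * ((2 * t ^ ε) * (decayConst δ * (3 * A))) := by gcongr
      _ = _ := by rw [← e2]; ring
  have k2 : 4 * (t ^ (5 / 9 : ℝ)) ^ 2 * ((t ^ (2 : ℝ))⁻¹ * (3 * A)) ≤ 12 * t ^ (-β + ε) * A := by
    have := mul_le_mul_of_nonneg_right e3 hA
    linarith
  have k3 : (t ^ (5 / 9 : ℝ)) ^ (r - 2 + δ) * (decayConst δ * A) ≤
      decayConst δ * t ^ (-β + ε) * A := by
    calc _ ≤ t ^ (-β + ε) * (decayConst δ * A) := by gcongr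
      _ = _ := by ring
  linarith

/-- One-dimensional factors at the frequency scale `Λ = t^{5/9}`, where `t^{1/3} Λ = t^{8/9}`. -/
theorem norm_integral_scaled_phase_le {t : ℝ} (ht : 1 ≤ t) {s : ℝ} (hs : 0 ≤ s) {μ : ℝ → ℂ}
    {c₁ c₂ : ℂ} (hc₁ : ‖c₁‖ ≤ 1) (hc₂ : ‖c₂‖ ≤ 1)
    (h₁ : ∀ ξ, 0 < ξ → μ ξ = c₁ * (ξ ^ s : ℝ)) (h₂ : ∀ ξ, 0 < ξ → μ (-ξ) = c₂ * (ξ ^ s : ℝ))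
    {γ : ℝ} (hγ1 : -(s + 1) / 3 ≤ γ) (hγ2 : -(s + 1) / 3 + 8 / 9 * (s - 1 / 2) ≤ γ) (z : ℝ) :
    ‖∫ η in (-t ^ (5 / 9 : ℝ))..(t ^ (5 / 9 : ℝ)),
      μ η * Complex.exp (Complex.I * ((z * η + t * η ^ 3 : ℝ) : ℂ))‖ ≤ 34 * t ^ γ := by
  have ht0 : 0 < t := by linarith
  have e : t ^ (1 / 3 : ℝ) * t ^ (5 / 9 : ℝ) = t ^ (8 / 9 : ℝ) := by
    rw [← Real.rpow_add ht0]; norm_num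
  refine (norm_integral_Icc_phase_le hs ht0 (e ▸ Real.one_le_rpow ht (by norm_num)) hc₁ hc₂ h₁ h₂
    z).trans ?_
  rw [e, ← Real.rpow_mul ht0.le, mul_assoc]
  refine mul_le_mul_of_nonneg_left ?_ (by norm_num)
  rw [mul_max_of_nonneg _ _ (by positivity), mul_one, ← Real.rpow_add ht0]
  exact max_le (Real.rpow_le_rpow_of_exponent_le ht hγ1) (Real.rpow_le_rpow_of_exponent_le ht hγ2)

/-- The kernel bound for a symbol depending on one coordinate only. -/
theorem norm_fourierInv_freqBox_coord_le {t : ℝ} (ht : 1 ≤ t) {s : ℝ} (hs : 0 ≤ s) {μ : ℝ → ℂ}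
    {c₁ c₂ : ℂ} (hc₁ : ‖c₁‖ ≤ 1) (hc₂ : ‖c₂‖ ≤ 1)
    (h₁ : ∀ ξ, 0 < ξ → μ ξ = c₁ * (ξ ^ s : ℝ)) (h₂ : ∀ ξ, 0 < ξ → μ (-ξ) = c₂ * (ξ ^ s : ℝ))
    {β : ℝ} (hβ1 : β ≤ 1 / 3 + (s + 1) / 3)
    (hβ2 : β ≤ 1 / 3 + (s + 1) / 3 - 8 / 9 * (s - 1 / 2)) (j : Fin 2) (z : Plane) :
    ‖𝓕⁻ ((freqBox (t ^ (5 / 9 : ℝ))).indicator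
      fun ξ => μ (2 * Real.pi * ξ j) * kernelSymbol t ξ) z‖ ≤ 34 ^ 2 * t ^ (-β) := by
  have ht0 : 0 < t := by linarith
  set ν : Fin 2 → ℝ → ℂ := fun i => if i = j then μ else fun _ => 1 with hν
  have hm : ∀ ξ : Plane, μ (2 * Real.pi * ξ j) =
      ν 0 (2 * Real.pi * ξ 0) * ν 1 (2 * Real.pi * ξ 1) := by
    intro ξ; fin_cases j <;> simp [hν]
  refine (norm_fourierInv_freqBox_le (by positivity) t hm z).trans ?_
  have hb : ∀ i, ‖∫ η in (-t ^ (5 / 9 : ℝ))..(t ^ (5 / 9 : ℝ)),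
      ν i η * Complex.exp (Complex.I * ((z i * η + t * η ^ 3 : ℝ) : ℂ))‖ ≤
      34 * t ^ (if i = j then 1 / 3 - β else -(1 / 3)) := by
    intro i
    by_cases hij : i = j
    · simp only [hν, if_pos hij]
      exact norm_integral_scaled_phase_le ht hs hc₁ hc₂ h₁ h₂ (by linarith) (by linarith) _
    · simp only [hν, if_neg hij]
      exact norm_integral_scaled_phase_le ht le_rfl (μ := fun _ => 1) (c₁ := 1) (c₂ := 1)
        (by simp) (by simp) (by simp) (by simp) (by norm_num) (by norm_num) _
  rw [Fin.prod_univ_two]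
  refine (mul_le_mul (hb 0) (hb 1) (norm_nonneg _) (by positivity)).trans (le_of_eq ?_)
  have : ∀ a b : ℝ, 34 * t ^ a * (34 * t ^ b) = 34 ^ 2 * t ^ (a + b) := fun a b => by
    rw [Real.rpow_add ht0]; ring
  rw [this]
  congr 2
  fin_cases j <;> simp <;> ring

theorem fourierMultiplier_one (g : L2) : fourierMultiplier (fun _ => 1) g = g := by
  have h : InDomain (fun _ => 1) g := by
    simpa [InDomain] using Lp.memLp (𝓕 g : L2)
  have e : (MemLp.toLp _ h : L2) = 𝓕 g := by
    refine Lp.ext ((MemLp.coeFn_toLp h).trans (.of_forall fun ξ => ?_))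
    exact one_mul _
  rw [fourierMultiplier, dif_pos h, e, FourierTransform.fourierInv_fourier_eq]

theorem abs_two_pi_mul_coord_le (j : Fin 2) (ξ : Plane) :
    |2 * Real.pi * ξ j| ≤ ‖(2 * Real.pi) • ξ‖ :=
  abs_le_of_sq_le_sq (coord_sq_le j ξ) (norm_nonneg _)

end ZK

end

theorem mainTheorem5 (ε : ℝ) (hε : 0 < ε) :
    ∃ C : ℝ≥0, ∀ (T : ℝ) (u : ℝ → ZK.L2),
      1 ≤ T → (∀ t ∈ Icc (1 : ℝ) T, ZK.H3norm (u t) < ∞) → ∀ t ∈ Icc (1 : ℝ) T,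
        eLpNorm (u t) ∞ volume
          ≤ C * ENNReal.ofReal (t ^ (-(2 / 3) + ε)) * ZK.Xnorm T u ∧
        eLpNorm (ZK.gradient (u t)) ∞ volume
          ≤ C * ENNReal.ofReal (t ^ (-(5 / 9) + ε)) * ZK.Xnorm T u ∧
        eLpNorm (ZK.halfDeriv 0 (u t)) ∞ volume
          ≤ C * ENNReal.ofReal (t ^ (-(5 / 6) + ε)) * ZK.Xnorm T u ∧
        eLpNorm (ZK.halfDeriv 1 (u t)) ∞ volume
          ≤ C * ENNReal.ofReal (t ^ (-(5 / 6) + ε)) * ZK.Xnorm T u := by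
  obtain ⟨C, hC0, hC⟩ := ZK.exists_ae_norm_fourierMultiplier_le
    (lt_min hε one_pos) (min_le_right ε 1)
  -- the factor `2` accounts for the two components of the gradient; the summand `1` makes the
  -- constant positive, so that nothing is claimed when `Xnorm T u = ∞`
  refine ⟨Real.toNNReal (2 * C + 1), fun T u _ _ t ht => ?_⟩
  have ht1 : 1 ≤ t := ht.1
  have ht0 : 0 < t := by linarith
  have hsup := le_iSup₂ (f := fun t (_ : t ∈ Icc 1 T) => max (ZK.H3norm (u t))
    (max (eLpNorm (fun x : ZK.Plane => ((x 0 : ℝ) : ℂ) * ZK.profile u t x) 2 volume)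
      (eLpNorm (fun x : ZK.Plane => ((x 1 : ℝ) : ℂ) * ZK.profile u t x) 2 volume))) t ht
  change _ ≤ ZK.Xnorm T u at hsup
  by_cases hX : ZK.Xnorm T u = ∞
  · have hinf : ∀ γ : ℝ, ((2 * C + 1).toNNReal : ℝ≥0∞) * ENNReal.ofReal (t ^ γ) * ∞ = ∞ := by
      intro γ
      refine ENNReal.mul_top (mul_ne_zero ?_ ?_)
      · rw [ENNReal.coe_ne_zero, Ne, Real.toNNReal_eq_zero]; linarith
      · rw [Ne, ENNReal.ofReal_eq_zero, not_le]; positivity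
    simp only [hX, hinf, le_top, and_self]
  obtain ⟨A, hA, hXA⟩ : ∃ A : ℝ, 0 ≤ A ∧ ZK.Xnorm T u = ENNReal.ofReal A :=
    ⟨_, ENNReal.toReal_nonneg, (ENNReal.ofReal_toReal hX).symm⟩
  rw [hXA, max_le_iff, max_le_iff] at hsup
  obtain ⟨hg, h0, h1⟩ := hsup
  have hmain : ∀ (r β : ℝ) (j : Fin 2) (μ : ℝ → ℂ) (c₁ c₂ : ℂ), 0 ≤ r → r ≤ 1 →
      β ≤ 5 / 9 * (2 - r) → β ≤ 1 / 3 + (r + 1) / 3 → β ≤ 8 / 9 →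
      β ≤ 1 / 3 + (r + 1) / 3 - 8 / 9 * (r - 1 / 2) → Measurable μ → (∀ η, ‖μ η‖ ≤ |η| ^ r) →
      ‖c₁‖ ≤ 1 → ‖c₂‖ ≤ 1 → (∀ ξ, 0 < ξ → μ ξ = c₁ * (ξ ^ r : ℝ)) →
      (∀ ξ, 0 < ξ → μ (-ξ) = c₂ * (ξ ^ r : ℝ)) →
      ∀ᵐ x, ‖ZK.fourierMultiplier (fun ξ => μ (2 * Real.pi * ξ j)) (u t) x‖ ≤
        C * t ^ (-β + ε) * A := by
    intro r β j μ c₁ c₂ hr hr1 hβ1 hβ2 hβ3 hβ4 hμ hμr hc₁ hc₂ e₁ e₂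
    filter_upwards [hC t A r β (fun ξ => μ (2 * Real.pi * ξ j)) (u t) ht1 hA hr hr1 hβ1 hβ3
      (by fun_prop) (fun ξ => (hμr _).trans (Real.rpow_le_rpow (abs_nonneg _)
        (ZK.abs_two_pi_mul_coord_le j ξ) hr))
      (ZK.norm_fourierInv_freqBox_coord_le ht1 hr hc₁ hc₂ e₁ e₂ hβ2 hβ4 j) hg h0 h1] with x hx
    refine hx.trans ?_
    gcongr
    exact min_le_left _ _
  have hfin : ∀ {E : Type} [NormedAddCommGroup E] (v : ZK.Plane → E) (γ : ℝ),
      (∀ᵐ x, ‖v x‖ ≤ 2 * (C * t ^ γ * A)) →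
      eLpNorm v ∞ volume ≤ ((2 * C + 1).toNNReal : ℝ≥0∞) * ENNReal.ofReal (t ^ γ) *
        ENNReal.ofReal A := by
    intro E _ v γ hv
    have htγ : 0 ≤ t ^ γ := by positivity
    rw [eLpNorm_exponent_top]
    refine (eLpNormEssSup_le_of_ae_bound hv).trans ?_
    rw [← ENNReal.ofReal, ← ENNReal.ofReal_mul (by positivity),
      ← ENNReal.ofReal_mul (by positivity)]
    refine ENNReal.ofReal_le_ofReal ?_
    nlinarith [mul_nonneg htγ hA]
  have hpos : ∀ γ : ℝ, 0 ≤ C * t ^ γ * A := fun γ => by positivity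
  have hgrad : ∀ j, ∀ᵐ x, ‖ZK.partialDeriv j (u t) x‖ ≤ C * t ^ (-(5 / 9) + ε) * A := fun j =>
    hmain 1 (5 / 9) j (fun η => Complex.I * (η : ℂ)) Complex.I (-Complex.I) (by norm_num)
      (by norm_num) (by norm_num) (by norm_num) (by norm_num) (by norm_num) (by fun_prop)
      (by simp) (by simp) (by simp) (by simp) (by simp)
  have hhalf : ∀ j, eLpNorm (ZK.halfDeriv j (u t)) ∞ volume ≤
      ((2 * C + 1).toNNReal : ℝ≥0∞) * ENNReal.ofReal (t ^ (-(5 / 6) + ε)) *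
        ENNReal.ofReal A := by
    intro j
    refine hfin _ _ ?_
    filter_upwards [hmain (1 / 2) (5 / 6) j (fun η => ((|η| ^ (1 / 2 : ℝ) : ℝ) : ℂ)) 1 1
      (by norm_num) (by norm_num) (by norm_num) (by norm_num) (by norm_num) (by norm_num)
      (by fun_prop)
      (fun η => by rw [Complex.norm_real, Real.norm_of_nonneg (by positivity)])
      (by simp) (by simp) (fun ξ hξ => by rw [abs_of_pos hξ, one_mul])
      (fun ξ hξ => by rw [abs_neg, abs_of_pos hξ, one_mul])] with x hx
    exact hx.trans (by linarith [hpos (-(5 / 6) + ε)])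
  rw [hXA]
  refine ⟨hfin _ _ ?_, hfin _ _ ?_, hhalf 0, hhalf 1⟩
  · filter_upwards [hmain 0 (2 / 3) 0 (fun _ => 1) 1 1 (by norm_num)
      (by norm_num) (by norm_num) (by norm_num) (by norm_num) (by norm_num) (by fun_prop)
      (by simp) (by simp) (by simp) (by simp) (by simp)] with x hx
    rw [ZK.fourierMultiplier_one] at hx
    exact hx.trans (by linarith [hpos (-(2 / 3) + ε)])
  · filter_upwards [hgrad 0, hgrad 1] with x hx0 hx1
    refine le_trans ?_ (by linarith : ‖ZK.partialDeriv 0 (u t) x‖ + ‖ZK.partialDeriv 1 (u t) x‖ ≤ _)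
    rw [ZK.gradient, EuclideanSpace.norm_eq, Fin.sum_univ_two]
    refine Real.sqrt_le_iff.2 ⟨by positivity, ?_⟩
    simp only [Matrix.cons_val_zero, Matrix.cons_val_one]
    nlinarith [mul_nonneg (norm_nonneg (ZK.partialDeriv 0 (u t) x))
      (norm_nonneg (ZK.partialDeriv 1 (u t) x))]
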